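/- **Setting.** Consider the system $$x_{k+1}=Ax_k+Bu_k+K\Sigma_e^{1/2}e_k,\qquad y_k=Cx_k+\Sigma_e^{1/2}e_k,\qquad k\ge 1,\quad x_1=0,$$ with $x_k\in\mathbb R^{n_x}$, $u_k\in\mathbb R^{n_u}$, $y_k,e_k\in\mathbb R^{n_y}$, $n_u,n_y\ge 1$ and $\Sigma_e\succ 0$. Assume that $\rho(A)<1$ and $\rho(A-KC)<1$, that $(A,[B\ K])$ is controllable and $(A,C)$ is observable, and that $(u_k)$ is i.i.d. $\mathcal N(0,\sigma_u^2I)$ with $\sigma_u>0$, $(e_k)$ is i.i.d. $\mathcal N(0,I)$, and the two sequences are independent. Norms of matrices are spectral norms. For horizons $p,f\ge 1$ and a number $N\ge 1$ of columns let $Y_p$, $U_p$, $U_f$ be the block Hankel matrices whose $k$-th columns ($k=1,\dots,N$) stack $y_k,\dots,y_{k+p-1}$, respectively $u_k,\dots,u_{k+p-1}$, respectively $u_{k+p},\dots,u_{k+p+f-1}$. Put $Z_p=\begin{bmatrix}Y_p\\U_p\end{bmatrix}$, $\Pi_{U_f}^{\perp}=I-U_f^\top(U_fU_f^\top)^{-1}U_f$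 and $$W_2=\Big(\tfrac1N Z_p\Pi_{U_f}^{\perp}Z_p^\top\Big)^{1/2}.$$ **Burn-in time.** For $0<\delta<1$ and $i\ge1$ let $d=p(n_u+n_y)+in_u$, $\bar u=n_u\sqrt{2n_u\log(32n_uN/\delta)}$, $\bar e=n_y\sqrt{2n_y\log(32n_yN/\delta)}$, $\bar w=\bar e\sqrt p+\bar u\sqrt{p+i}$, $\bar r=2\bar w^2\sqrt{2\log(d/\delta)}$ and $N_W=4\bar r^2$ (which depends on $N$). Let $G_p$ be the block lower-triangular Toeplitz matrix with zero diagonal blocks and blocks $CA^{a-b-1}B$ at positions $a>b$. Let $H_p$ be the one with diagonal blocks $\Sigma_e^{1/2}$ and blocks $CA^{a-b-1}K\Sigma_e^{1/2}$ at positions $a>b$. Let $$\mathcal T=\begin{bmatrix}G_p&0&H_p\\I&0&0\\0&I&0\end{bmatrix},\qquad \Lambda=\mathrm{diag}(\sigma_u,\dots,\sigma_u,1,\dots,1),\qquad \bar\sigma=\tfrac12\|\mathcal T\|\|\Lambda\|,$$ with $\sigma_u$ on the input coordinates and $1$ on the innovation coordinates, let $\Sigma_{x,N}=\mathbb E[x_Nx_N^\top]$,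 and let $$C_{XE}=4\log\det\Big(I+\tfrac{2n_x}{\delta}\Sigma_{x,N}\Big)+8\log\tfrac{2\cdot 5^{d}}{\delta},\qquad \gamma_N=2\|\mathcal T\|\|\Lambda\|\sqrt{C_{XE}/N}.$$ Define $N_\Phi=\min\{N\ge1:\gamma_N\le\min\{1,\bar\sigma^2\}\}$ and $N_{pe}(\delta,p,i)=\min\{N\ge 1: N\ge N_W,\ N\ge N_\Phi\}$. **Statement.** Fix $0<\delta<1$, $f\ge1$ and $\beta\in\mathbb R$. There are constants $C_1,C_2$, not depending on $N$ or $p$, such that for all integers $p,N\ge1$ with $p\le\beta(1+\log N)$ and $N\ge N_{pe}(\delta,p,f)$, with probability at least $1-\frac{3\delta}{2}-\delta_u$, where $$\delta_u=(2(N+f-1)n_u)^{-\log^2(2fn_u)\,\log(2(N+f-1)n_u)},$$ the matrix $U_fU_f^\top$ is positive definite (so that $W_2$ is well defined) and 1. $W_2$ is positive definite; 2. $\|W_2\|\le C_1\log N$; 3. $\|W_2^{-1}\|\le C_2$. (Any fixed $p$ is covered by taking $\beta=p$, and a past horizon of order $\log N$ is covered by a suitable $\beta$.) -/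

import Mathlib

open MeasureTheory ProbabilityTheory Matrix
open scoped MatrixOrder Matrix.Norms.L2Operator

namespace SubspaceId

/-- The matrices of the innovations-form model
`x (k+1) = A x k + B u k + K Σe^(1/2) e k`, `y k = C x k + Σe^(1/2) e k`. -/
structure LinSys (nx nu ny : ℕ) where
  A : Matrix (Fin nx) (Fin nx) ℝ
  B : Matrix (Fin nx) (Fin nu) ℝ
  C : Matrix (Fin ny) (Fin nx) ℝ
  K : Matrix (Fin nx) (Fin ny) ℝ
  Se : Matrix (Fin ny) (Fin ny) ℝ

/-- The spectral radius of a real square matrix: the largest modulus of a complex eigenvalue. -/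
noncomputable def specRad {n : ℕ} (M : Matrix (Fin n) (Fin n) ℝ) : ENNReal :=
  spectralRadius ℂ (M.map (algebraMap ℝ ℂ))

/-- Kalman rank condition: `[B, A B, ..., A^(n-1) B]` has rank `n`. -/
def Controllable {n : ℕ} {κ : Type} [Fintype κ]
    (A : Matrix (Fin n) (Fin n) ℝ) (B : Matrix (Fin n) κ ℝ) : Prop :=
  (Matrix.of fun (r : Fin n) (c : Fin n × κ) => (A ^ (c.1 : ℕ) * B) r c.2).rank = n

/-- Kalman rank condition: the matrix with block rows `C, C A, ..., C A^(n-1)` has rank `n`. -/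
def Observable {n m : ℕ}
    (A : Matrix (Fin n) (Fin n) ℝ) (C : Matrix (Fin m) (Fin n) ℝ) : Prop :=
  (Matrix.of fun (r : Fin n × Fin m) (c : Fin n) => (C * A ^ (r.1 : ℕ)) r.2 c).rank = n

/-- A random sequence of vectors of length `n`, indexed by time. -/
abbrev RandSeq (Ω : Type*) (n : ℕ) := ℕ → Ω → Fin n → ℝ

/-- `s 0, s 1, ...` are independent and each has the law `N(0, v I)`. -/
def IsGaussianWhiteNoise {Ω : Type*} [MeasurableSpace Ω] (μ : Measure Ω) {n : ℕ}
    (s : RandSeq Ω n) (v : ℝ) : Prop :=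
  (∀ k, Measurable (s k)) ∧
  (∀ k, μ.map (s k) = Measure.pi fun _ : Fin n => gaussianReal 0 v.toNNReal) ∧
  iIndepFun s μ

/-- The data Hankel matrix with `h` block rows and `N` columns whose `j`-th column
(`j = 0, ..., N-1`) stacks `s (t+j), ..., s (t+j+h-1)`. -/
def hankel {n : ℕ} (s : ℕ → Fin n → ℝ) (t h N : ℕ) : Matrix (Fin h × Fin n) (Fin N) ℝ :=
  Matrix.of fun r j => s (t + j + r.1) r.2

namespace LinSys

variable {nx nu ny : ℕ} (S : LinSys nx nu ny)

/-- The predictor matrix `A - K C`. -/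
def AK : Matrix (Fin nx) (Fin nx) ℝ := S.A - S.K * S.C

/-- The positive semidefinite square root of the innovations covariance. -/
noncomputable def SeSqrt : Matrix (Fin ny) (Fin ny) ℝ := CFC.sqrt S.Se

/-- The state sequence. Time starts at `k = 1` with `x 1 = 0`; the value at index `0` is not
used. -/
noncomputable def state {Ω : Type*} (u : RandSeq Ω nu) (e : RandSeq Ω ny) : RandSeq Ω nx
  | 0 => fun _ => 0
  | 1 => fun _ => 0
  | k + 2 => fun ω =>
      S.A *ᵥ state u e (k + 1) ω + S.B *ᵥ u (k + 1) ω + (S.K * S.SeSqrt) *ᵥ e (k + 1) ω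

/-- The output sequence. -/
noncomputable def output {Ω : Type*} (u : RandSeq Ω nu) (e : RandSeq Ω ny) : RandSeq Ω ny :=
  fun k ω => S.C *ᵥ S.state u e k ω + S.SeSqrt *ᵥ e k ω

/-- The covariance `E[x k (x k)ᵀ]` of the state at time `k`. -/
noncomputable def stateCov {Ω : Type*} [MeasurableSpace Ω] (μ : Measure Ω)
    (u : RandSeq Ω nu) (e : RandSeq Ω ny) (k : ℕ) : Matrix (Fin nx) (Fin nx) ℝ :=
  Matrix.of fun a b => ∫ ω, S.state u e k ω a * S.state u e k ω b ∂μ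

/-- The block lower-triangular Toeplitz matrix of the Markov parameters `C A^l B` from the
input to the output, with zero diagonal blocks. -/
def G (p : ℕ) : Matrix (Fin p × Fin ny) (Fin p × Fin nu) ℝ :=
  Matrix.of fun r c =>
    if c.1 < r.1 then (S.C * S.A ^ ((r.1 : ℕ) - c.1 - 1) * S.B) r.2 c.2 else 0

/-- The block lower-triangular Toeplitz matrix from the innovations to the output: `Σe^(1/2)` on
the diagonal and `C A^l K Σe^(1/2)` below it. -/
noncomputable def H (p : ℕ) : Matrix (Fin p × Fin ny) (Fin p × Fin ny) ℝ :=
  Matrix.of fun r c =>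
    if c.1 < r.1 then (S.C * S.A ^ ((r.1 : ℕ) - c.1 - 1) * S.K * S.SeSqrt) r.2 c.2
    else if c.1 = r.1 then S.SeSqrt r.2 c.2 else 0

/-- The matrix `[G 0 H; I 0 0; 0 I 0]`, mapping the stacked past inputs, `i` future inputs and
past innovations to the stacked past outputs, past inputs and `i` future inputs
(for zero initial state). -/
noncomputable def T (p i : ℕ) :
    Matrix ((Fin p × Fin ny) ⊕ ((Fin p × Fin nu) ⊕ (Fin i × Fin nu)))
      (((Fin p × Fin nu) ⊕ (Fin i × Fin nu)) ⊕ (Fin p × Fin ny)) ℝ :=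
  Matrix.fromBlocks (Matrix.fromCols (S.G p) 0) (S.H p) 1 0

end LinSys

/-- `diag(σ, ..., σ, 1, ..., 1)`: `σ` on the input coordinates, `1` on the innovation
coordinates. -/
def Lam (nu ny p i : ℕ) (σ : ℝ) :
    Matrix (((Fin p × Fin nu) ⊕ (Fin i × Fin nu)) ⊕ (Fin p × Fin ny))
      (((Fin p × Fin nu) ⊕ (Fin i × Fin nu)) ⊕ (Fin p × Fin ny)) ℝ :=
  Matrix.diagonal (Sum.elim (fun _ => σ) fun _ => 1)

section BurnIn

/-- The problem dimension `p (nu + ny) + i nu`. -/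
def dimP (nu ny p i : ℕ) : ℕ := p * (nu + ny) + i * nu

/-- `n √(2 n log(32 n N / δ))`. -/
noncomputable def noiseBound (n N : ℕ) (δ : ℝ) : ℝ :=
  n * Real.sqrt (2 * n * Real.log (32 * n * N / δ))

/-- `ē √p + ū √(p+i)`. -/
noncomputable def wBar (nu ny p i N : ℕ) (δ : ℝ) : ℝ :=
  noiseBound ny N δ * Real.sqrt p + noiseBound nu N δ * Real.sqrt (p + i)

/-- `2 w̄² √(2 log(d/δ))`. -/
noncomputable def rBar (nu ny p i N : ℕ) (δ : ℝ) : ℝ :=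
  2 * wBar nu ny p i N δ ^ 2 * Real.sqrt (2 * Real.log (dimP nu ny p i / δ))

/-- The threshold `N_W = 4 r̄²`, which itself depends on `N` logarithmically. -/
noncomputable def NW (nu ny p i N : ℕ) (δ : ℝ) : ℝ := 4 * rBar nu ny p i N δ ^ 2

variable {nx nu ny : ℕ} (S : LinSys nx nu ny) {Ω : Type*} [MeasurableSpace Ω] (μ : Measure Ω)
  (u : RandSeq Ω nu) (e : RandSeq Ω ny) (σ δ : ℝ) (p i : ℕ)

/-- `σ̄ = ‖T‖ ‖Λ‖ / 2`. -/
noncomputable def sigmaBar : ℝ := ‖S.T p i‖ * ‖Lam nu ny p i σ‖ / 2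

/-- `4 log det(I + (2 nx / δ) E[x N (x N)ᵀ]) + 8 log(5^d 2 / δ)`. -/
noncomputable def CXE (N : ℕ) : ℝ :=
  4 * Real.log (1 + (2 * nx / δ) • S.stateCov μ u e N).det
    + 8 * Real.log (5 ^ dimP nu ny p i * 2 / δ)

/-- `γ_N = 2 ‖T‖ ‖Λ‖ √(C_XE / N)`. -/
noncomputable def gam (N : ℕ) : ℝ :=
  2 * ‖S.T p i‖ * ‖Lam nu ny p i σ‖ * Real.sqrt (CXE S μ u e δ p i N / N)

/-- The threshold `N_Φ`: the least sample size `N ≥ 1` with `γ_N ≤ min(1, σ̄²)`. -/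
noncomputable def NPhi : ℕ :=
  sInf {N : ℕ | 1 ≤ N ∧ gam S μ u e σ δ p i N ≤ min 1 (sigmaBar S σ p i ^ 2)}

/-- The burn-in time `N_pe(δ, p, i)`: the least sample size `N ≥ 1` with `N ≥ N_W` and
`N ≥ N_Φ`. -/
noncomputable def burnIn : ℕ :=
  sInf {N : ℕ | 1 ≤ N ∧ NW nu ny p i N δ ≤ N ∧ NPhi S μ u e σ δ p i ≤ N}

end BurnIn

/-- The confidence loss
`δ_u = (2 (N+f-1) nu) ^ (-log²(2 f nu) log(2 (N+f-1) nu))`. -/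
noncomputable def deltaU (nu f N : ℕ) : ℝ :=
  (2 * ((N : ℝ) + f - 1) * nu) ^
    (-(Real.log (2 * f * nu) ^ 2 * Real.log (2 * ((N : ℝ) + f - 1) * nu)))

section Weighting

variable {Ω : Type*} {nx nu ny : ℕ} (S : LinSys nx nu ny) (u : RandSeq Ω nu) (e : RandSeq Ω ny)

/-- The matrix of future inputs: its columns stack `u (k+p), ..., u (k+p+f-1)`,
`k = 1, ..., N`. -/
def Uf (p f N : ℕ) (ω : Ω) : Matrix (Fin f × Fin nu) (Fin N) ℝ :=
  hankel (fun k => u k ω) (1 + p) f N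

/-- The matrix of past outputs above past inputs: its columns stack `y k, ..., y (k+p-1)` and
`u k, ..., u (k+p-1)`, `k = 1, ..., N`. -/
noncomputable def Zp (p N : ℕ) (ω : Ω) :
    Matrix ((Fin p × Fin ny) ⊕ (Fin p × Fin nu)) (Fin N) ℝ :=
  Matrix.fromRows (hankel (fun k => S.output u e k ω) 1 p N) (hankel (fun k => u k ω) 1 p N)

/-- `I - Uᵀ (U Uᵀ)⁻¹ U`. -/
noncomputable def projPerp {m : Type*} [Fintype m] [DecidableEq m] {N : ℕ}
    (U : Matrix m (Fin N) ℝ) : Matrix (Fin N) (Fin N) ℝ :=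
  1 - Uᵀ * (U * Uᵀ)⁻¹ * U

/-- The weighting matrix `W₂ = ((1/N) Zp Π Zpᵀ)^(1/2)`, where `Π` projects onto the orthogonal
complement of the row space of the future inputs. -/
noncomputable def W2 (p f N : ℕ) (ω : Ω) :
    Matrix ((Fin p × Fin ny) ⊕ (Fin p × Fin nu)) ((Fin p × Fin ny) ⊕ (Fin p × Fin nu)) ℝ :=
  CFC.sqrt ((1 / (N : ℝ)) • (Zp S u e p N ω * projPerp (Uf u p f N ω) * (Zp S u e p N ω)ᵀ))

end Weighting

end SubspaceId

/-! Since δ is fixed, the constants may depend on δ in any way, so second moments and Markov's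
inequality suffice in place of sharp concentration. Two events, each failing with probability at
most δ/2, already give probability 1 - δ; the remaining δ/2 and the nonnegative `deltaU` are slack.

Deterministically (`weighting_bounds`), W₂² is a normalized Schur complement. A bound |Zᵀv + Uᵀs|² ≥
cN(|v|² + |s|²) for all v, s makes U Uᵀ and W₂ positive definite with ‖W₂⁻¹‖ ≤ c^(-1/2), and a bound
on the Frobenius norm of Z bounds ‖W₂‖. The latter has mean square O(Np), because stability of A
keeps the state moments bounded; and p = O(log N).

For the lower bound, duality (`sum_dotProduct_output`) writes each entry of Zᵀv + Uᵀs as ⟨b, x⟩ +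
⟨a, g⟩, with x the state at the start of a window and g the independent noises inside it
(`weighted_column_eq`). Recovering (v, s) from a runs the adjoint system with A - KC in place of A.
Stability of A - KC therefore bounds |v|² + |s|² and |b|² by a multiple of |a|², uniformly in p and
f (`exists_windowWeights_bound`).

It remains to bound the sum over k of (⟨b, x_k⟩ + ⟨a, g_k⟩)² below by a multiple of N|a|², with a
factor uniform in p and N. For large N, the empirical moments of g gᵀ and g xᵀ concentrate with
failure probability O(d²/N) (`exists_dataExcited_large`), which tends to 0 because d = O(log N).
Only finitely many pairs (p, N) are left. For each of them N ≥ d² leaves room for d disjoint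
windows, whose d × d matrix of forms is almost surely invertible (`exists_dataExcited`), and a
minimum of finitely many positive constants is positive. The burn-in time enters only through N ≥ d²
(`sq_dimP_le_of_burnIn_le`). -/

namespace SubspaceId

/-! ### Euclidean norms and stable linear recursions -/

section Stability

/-- The squared Euclidean norm of a real vector. -/
def sqNorm {ι : Type*} [Fintype ι] (x : ι → ℝ) : ℝ := ∑ i, x i ^ 2

variable {ι κ : Type*} [Fintype ι] [Fintype κ]

lemma sqNorm_nonneg (x : ι → ℝ) : 0 ≤ sqNorm x := Finset.sum_nonneg fun _ _ => sq_nonneg _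

@[simp] lemma sqNorm_zero : sqNorm (0 : ι → ℝ) = 0 := by simp [sqNorm]

lemma sqNorm_eq_norm_sq (x : ι → ℝ) : sqNorm x = ‖WithLp.toLp 2 x‖ ^ 2 := by
  rw [EuclideanSpace.real_norm_sq_eq]; rfl

lemma sqNorm_eq_dotProduct (x : ι → ℝ) : sqNorm x = x ⬝ᵥ x := by
  simp [sqNorm, dotProduct, sq]

lemma sqNorm_eq_zero {x : ι → ℝ} : sqNorm x = 0 ↔ x = 0 := by
  rw [sqNorm_eq_dotProduct, dotProduct_self_eq_zero]

lemma sqNorm_add_le (x y : ι → ℝ) : sqNorm (x + y) ≤ 2 * sqNorm x + 2 * sqNorm y := by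
  simp only [sqNorm, Finset.mul_sum, ← Finset.sum_add_distrib, Pi.add_apply]
  exact Finset.sum_le_sum fun i _ => by nlinarith [sq_nonneg (x i - y i)]

lemma sqNorm_add_le' (x y : ι → ℝ) {ε : ℝ} (hε : 0 < ε) :
    sqNorm (x + y) ≤ (1 + ε) * sqNorm x + (1 + ε⁻¹) * sqNorm y := by
  simp only [sqNorm, Finset.mul_sum, ← Finset.sum_add_distrib, Pi.add_apply]
  refine Finset.sum_le_sum fun i _ => ?_
  have h : 0 ≤ ε⁻¹ * (ε * x i - y i) ^ 2 := by positivity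
  have h2 : ε⁻¹ * (ε * x i - y i) ^ 2 = ε * x i ^ 2 - 2 * x i * y i + ε⁻¹ * y i ^ 2 := by
    field_simp; ring
  nlinarith

lemma dotProduct_sq_le (x y : ι → ℝ) : (x ⬝ᵥ y) ^ 2 ≤ sqNorm x * sqNorm y := by
  simpa [sqNorm, dotProduct] using Finset.sum_mul_sq_le_sq_mul_sq Finset.univ x y

lemma sqNorm_mulVec_le [DecidableEq κ] (M : Matrix ι κ ℝ) (x : κ → ℝ) :
    sqNorm (M *ᵥ x) ≤ ‖M‖ ^ 2 * sqNorm x := by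
  rw [sqNorm_eq_norm_sq, sqNorm_eq_norm_sq, ← mul_pow]
  exact pow_le_pow_left₀ (norm_nonneg _) (l2_opNorm_mulVec M (WithLp.toLp 2 x)) 2

lemma norm_le_of_sqNorm_mulVec_le [DecidableEq κ] {M : Matrix ι κ ℝ} {t : ℝ} (ht : 0 ≤ t)
    (h : ∀ x, sqNorm (M *ᵥ x) ≤ t * sqNorm x) : ‖M‖ ≤ √t := by
  rw [l2_opNorm_def]
  refine ContinuousLinearMap.opNorm_le_bound _ (Real.sqrt_nonneg _) fun x => ?_
  have h1 := h x.ofLp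
  rw [sqNorm_eq_norm_sq, sqNorm_eq_norm_sq] at h1
  have h2 : ‖WithLp.toLp 2 (M *ᵥ x.ofLp)‖ ≤ √(t * ‖x‖ ^ 2) := Real.le_sqrt_of_sq_le h1
  rw [Real.sqrt_mul ht, Real.sqrt_sq (norm_nonneg _)] at h2
  exact h2

/-- Real vectors embed isometrically into complex ones. This transfers Gelfand's formula, which
lives over ℂ, to real matrices. -/
lemma norm_le_norm_map_complex {n : ℕ} (M : Matrix (Fin n) (Fin n) ℝ) :
    ‖M‖ ≤ ‖M.map (algebraMap ℝ ℂ)‖ := by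
  have key : ∀ x : Fin n → ℝ, sqNorm (M *ᵥ x) ≤ ‖M.map (algebraMap ℝ ℂ)‖ ^ 2 * sqNorm x := by
    intro x
    have h := l2_opNorm_mulVec (M.map (algebraMap ℝ ℂ))
      (WithLp.toLp 2 fun i => (algebraMap ℝ ℂ) (x i))
    have e1 : ∀ y : Fin n → ℝ, ‖WithLp.toLp 2 (fun i => (algebraMap ℝ ℂ) (y i))‖ ^ 2
        = sqNorm y := by
      intro y
      rw [EuclideanSpace.norm_sq_eq]
      simp [sqNorm]
    have e2 : (M.map (algebraMap ℝ ℂ)) *ᵥ (fun i => (algebraMap ℝ ℂ) (x i))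
        = fun i => (algebraMap ℝ ℂ) ((M *ᵥ x) i) := by
      ext i
      exact ((algebraMap ℝ ℂ).map_mulVec M x i).symm
    have h2 := pow_le_pow_left₀ (norm_nonneg _) h 2
    rw [mul_pow, e1, ← e1 (M *ᵥ x)] at *
    rw [← e2]
    exact h2
  calc ‖M‖ ≤ √(‖M.map (algebraMap ℝ ℂ)‖ ^ 2) :=
        norm_le_of_sqNorm_mulVec_le (sq_nonneg _) key
    _ = _ := Real.sqrt_sq (norm_nonneg _)

/-- Gelfand's formula: ‖M^m‖^(1/m) tends to the spectral radius, hence drops below any η strictly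
between it and 1. -/
lemma exists_norm_pow_le_of_specRad_lt_one {n : ℕ} {M : Matrix (Fin n) (Fin n) ℝ}
    (h : specRad M < 1) : ∃ m : ℕ, ∃ η : ℝ, 0 < m ∧ 0 < η ∧ η < 1 ∧ ‖M ^ m‖ ≤ η ^ m := by
  obtain ⟨η, h1, h2⟩ := ENNReal.lt_iff_exists_nnreal_btwn.1 h
  have h3 := (spectrum.pow_nnnorm_pow_one_div_tendsto_nhds_spectralRadius
    (M.map (algebraMap ℝ ℂ))).eventually_lt_const h1
  obtain ⟨m, hm, hm0⟩ := (h3.and (Filter.eventually_gt_atTop 0)).exists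
  refine ⟨m, η, hm0, ?_, by exact_mod_cast h2, ?_⟩
  · have : (0 : ENNReal) < η := lt_of_le_of_lt bot_le h1
    exact_mod_cast this
  · have hm' : (0 : ℝ) < m := by exact_mod_cast hm0
    have h4 : (‖M.map (algebraMap ℝ ℂ) ^ m‖₊ : ENNReal) ≤ (η : ENNReal) ^ m := by
      have h5 := ENNReal.rpow_le_rpow hm.le hm'.le
      rw [← ENNReal.rpow_mul, one_div_mul_cancel hm'.ne', ENNReal.rpow_one,
        ENNReal.rpow_natCast] at h5
      exact h5
    have h6 : ‖M.map (algebraMap ℝ ℂ) ^ m‖ ≤ (η : ℝ) ^ m := by exact_mod_cast h4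
    have h7 : (M ^ m).map (algebraMap ℝ ℂ) = M.map (algebraMap ℝ ℂ) ^ m :=
      Matrix.map_pow M (algebraMap ℝ ℂ) m
    exact (norm_le_norm_map_complex _).trans (h7 ▸ h6)

/-- A quadratic Lyapunov function for a matrix with a contractive power. -/
lemma exists_lyapunov {n m : ℕ} {M : Matrix (Fin n) (Fin n) ℝ} {η : ℝ} (hm : 0 < m)
    (hη0 : 0 < η) (hη1 : η < 1) (h : ‖M ^ m‖ ≤ η ^ m) :
    ∃ (V : (Fin n → ℝ) → ℝ) (ρ C : ℝ), 0 ≤ ρ ∧ ρ < 1 ∧ 0 ≤ C ∧ V 0 = 0 ∧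
      (∀ x, sqNorm x ≤ V x) ∧ ∀ x q, V (M *ᵥ x + q) ≤ ρ * V x + C * sqNorm q := by
  set θ := η ^ 2 with hθ
  have hθ0 : 0 < θ := by positivity
  have hθ1 : θ < 1 := by nlinarith
  -- Weighting |M^k x|² by θ^(-k) makes the shift k ↦ k+1 contract by θ; the term k = m that enters
  -- is dominated by the term k = 0 that leaves, since ‖M^m‖² ≤ θ^m.
  set V : (Fin n → ℝ) → ℝ := fun x => ∑ k ∈ Finset.range m, (θ ^ k)⁻¹ * sqNorm (M ^ k *ᵥ x)
  -- Small enough that (1 + ε)θ < 1, so the cross term with the forcing is absorbed.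
  set ε := (1 - θ) / 2
  have hε : 0 < ε := by simp only [ε]; linarith
  set C0 := ∑ k ∈ Finset.range m, (θ ^ k)⁻¹ * ‖M ^ k‖ ^ 2
  have hC0 : 0 ≤ C0 := Finset.sum_nonneg fun _ _ => by positivity
  have hVC : ∀ x, V x ≤ C0 * sqNorm x := by
    intro x
    simp only [V, C0, Finset.sum_mul]
    refine Finset.sum_le_sum fun k _ => ?_
    rw [mul_assoc]
    exact mul_le_mul_of_nonneg_left (sqNorm_mulVec_le _ _) (by positivity)
  have hV0 : ∀ x, 0 ≤ V x := fun x =>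
    Finset.sum_nonneg fun k _ => mul_nonneg (by positivity) (sqNorm_nonneg _)
  have hVM : ∀ x, V (M *ᵥ x) ≤ θ * V x := by
    intro x
    have e1 : V (M *ᵥ x) = θ * ∑ k ∈ Finset.range m, (θ ^ (k + 1))⁻¹ * sqNorm (M ^ (k + 1) *ᵥ x) := by
      simp only [V, Finset.mul_sum]
      refine Finset.sum_congr rfl fun k _ => ?_
      rw [mulVec_mulVec, ← pow_succ, pow_succ θ]
      field_simp
    have e2 := Finset.sum_range_succ (fun k => (θ ^ k)⁻¹ * sqNorm (M ^ k *ᵥ x)) m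
    rw [Finset.sum_range_succ'] at e2
    have e3 : (θ ^ m)⁻¹ * sqNorm (M ^ m *ᵥ x) ≤ sqNorm x := by
      have h1 := sqNorm_mulVec_le (M ^ m) x
      have h2 : ‖M ^ m‖ ^ 2 ≤ θ ^ m := by
        rw [hθ, ← pow_mul, mul_comm 2 m, pow_mul]
        exact pow_le_pow_left₀ (norm_nonneg _) h 2
      rw [inv_mul_le_iff₀ (by positivity)]
      exact h1.trans (mul_le_mul_of_nonneg_right h2 (sqNorm_nonneg _))
    simp only [pow_zero, inv_one, one_mul, one_mulVec] at e2
    rw [e1]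
    refine mul_le_mul_of_nonneg_left ?_ hθ0.le
    simp only [V]
    linarith
  have hVadd : ∀ x y, V (x + y) ≤ (1 + ε) * V x + (1 + ε⁻¹) * V y := by
    intro x y
    simp only [V, Finset.mul_sum, ← Finset.sum_add_distrib]
    refine Finset.sum_le_sum fun k _ => ?_
    rw [mulVec_add]
    have h1 := sqNorm_add_le' (M ^ k *ᵥ x) (M ^ k *ᵥ y) hε
    have h2 : 0 ≤ (θ ^ k)⁻¹ := by positivity
    nlinarith [mul_le_mul_of_nonneg_left h1 h2]
  refine ⟨V, (1 + ε) * θ, (1 + ε⁻¹) * C0, by positivity, ?_, by positivity, by simp [V], ?_, ?_⟩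
  · simp only [ε]; nlinarith
  · intro x
    have h1 := Finset.single_le_sum (s := Finset.range m)
      (f := fun k => (θ ^ k)⁻¹ * sqNorm (M ^ k *ᵥ x))
      (fun k _ => mul_nonneg (by positivity) (sqNorm_nonneg _)) (Finset.mem_range.2 hm)
    simpa using h1
  · intro x q
    have h1 := hVadd (M *ᵥ x) q
    have h2 : (1 + ε) * V (M *ᵥ x) ≤ (1 + ε) * (θ * V x) :=
      mul_le_mul_of_nonneg_left (hVM x) (by positivity)
    have h3 : (1 + ε⁻¹) * V q ≤ (1 + ε⁻¹) * (C0 * sqNorm q) :=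
      mul_le_mul_of_nonneg_left (hVC q) (by positivity)
    linarith

/-- Stable linear recursions are bounded in `ℓ²`. -/
lemma exists_sum_sqNorm_le {n m : ℕ} {M : Matrix (Fin n) (Fin n) ℝ} {η : ℝ} (hm : 0 < m)
    (hη0 : 0 < η) (hη1 : η < 1) (h : ‖M ^ m‖ ≤ η ^ m) :
    ∃ C : ℝ, 0 ≤ C ∧ ∀ (z q : ℕ → Fin n → ℝ) (T : ℕ), z 0 = 0 →
      (∀ t < T, z (t + 1) = M *ᵥ z t + q t) →
      ∑ t ∈ Finset.range (T + 1), sqNorm (z t) ≤ C * ∑ t ∈ Finset.range T, sqNorm (q t) := by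
  obtain ⟨V, ρ, C, hρ0, hρ1, hC, hV0, hV1, hV2⟩ := exists_lyapunov hm hη0 hη1 h
  have hρ : 0 < 1 - ρ := by linarith
  refine ⟨C / (1 - ρ), by positivity, fun z q T hz hrec => ?_⟩
  -- Summing the Lyapunov inequality over time leaves a factor 1 - ρ in front of the sum of V.
  have key : ∀ t ≤ T, (1 - ρ) * ∑ j ∈ Finset.range t, V (z j) + V (z t)
      ≤ C * ∑ j ∈ Finset.range t, sqNorm (q j) := by
    intro t
    induction t with
    | zero => intro _; simp [hz, hV0]
    | succ t ih =>
      intro ht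
      have h1 := ih (by omega)
      have h2 := hV2 (z t) (q t)
      rw [← hrec t (by omega)] at h2
      rw [Finset.sum_range_succ, Finset.sum_range_succ]
      linarith
  have hVn : ∀ x, 0 ≤ V x := fun x => (sqNorm_nonneg x).trans (hV1 x)
  have h1 := key T le_rfl
  rw [div_mul_eq_mul_div, le_div_iff₀ hρ]
  have h2 : ∑ t ∈ Finset.range (T + 1), sqNorm (z t) ≤ ∑ t ∈ Finset.range T, V (z t) + V (z T) := by
    rw [Finset.sum_range_succ]
    exact add_le_add (Finset.sum_le_sum fun _ _ => hV1 _) (hV1 _)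
  nlinarith [hVn (z T), mul_le_mul_of_nonneg_right h2 hρ.le]

end Stability

/-! ### The adjoint system and the indexing of data windows -/

section Costate

variable {nx ny nu : ℕ}

/-- The adjoint state of the output weights `w 0, ..., w (p-1)`, run backwards from time `p`. -/
def costate (A : Matrix (Fin nx) (Fin nx) ℝ) (C : Matrix (Fin ny) (Fin nx) ℝ)
    (w : ℕ → Fin ny → ℝ) (p : ℕ) : ℕ → Fin nx → ℝ
  | 0 => 0
  | t + 1 => Aᵀ *ᵥ costate A C w p t + Cᵀ *ᵥ w (p - 1 - t)

/-- Summation by parts: the pairing of the costate at p - r with x r telescopes, the final costate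
being 0. -/
lemma sum_dotProduct_output (A : Matrix (Fin nx) (Fin nx) ℝ) (C : Matrix (Fin ny) (Fin nx) ℝ)
    (w : ℕ → Fin ny → ℝ) (p : ℕ) (x q : ℕ → Fin nx → ℝ)
    (hx : ∀ r, x (r + 1) = A *ᵥ x r + q r) :
    ∑ r ∈ Finset.range p, w r ⬝ᵥ (C *ᵥ x r) = costate A C w p p ⬝ᵥ x 0 +
      ∑ r ∈ Finset.range p, costate A C w p (p - 1 - r) ⬝ᵥ q r := by
  have h := Finset.sum_range_sub' (fun r => costate A C w p (p - r) ⬝ᵥ x r) p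
  simp only [Nat.sub_zero, Nat.sub_self, costate, zero_dotProduct, sub_zero] at h
  rw [← h, ← Finset.sum_add_distrib]
  refine Finset.sum_congr rfl fun r hr => ?_
  have hr' := Finset.mem_range.1 hr
  obtain ⟨t, ht⟩ : ∃ t, p - r = t + 1 := ⟨p - r - 1, by omega⟩
  have e1 : p - (r + 1) = t := by omega
  have e2 : p - 1 - r = t := by omega
  have e3 : p - 1 - t = r := by omega
  rw [ht, e1, e2, hx r, costate, e3, add_dotProduct, dotProduct_add, mulVec_transpose,
    mulVec_transpose, ← dotProduct_mulVec, ← dotProduct_mulVec]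
  ring

/-- The indices of a data window: past inputs, future inputs, past innovations. -/
abbrev WinIdx (nu ny p f : ℕ) := ((Fin p × Fin nu) ⊕ (Fin f × Fin nu)) ⊕ (Fin p × Fin ny)

/-- The time offset and the noise channel of a window index. -/
def winPos {nu ny p f : ℕ} : WinIdx nu ny p f → ℕ × (Fin nu ⊕ Fin ny)
  | Sum.inl (Sum.inl r) => (r.1, Sum.inl r.2)
  | Sum.inl (Sum.inr r) => (p + r.1, Sum.inl r.2)
  | Sum.inr r => (r.1, Sum.inr r.2)

lemma winPos_injective {nu ny p f : ℕ} :
    Function.Injective (winPos : WinIdx nu ny p f → ℕ × (Fin nu ⊕ Fin ny)) := by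
  rintro ((⟨i, c⟩ | ⟨i, c⟩) | ⟨i, c⟩) ((⟨j, c'⟩ | ⟨j, c'⟩) | ⟨j, c'⟩) h <;>
    simp [winPos] at h ⊢
  · exact ⟨Fin.ext h.1, h.2⟩
  · have := i.2; omega
  · have := j.2; omega
  · exact ⟨Fin.ext h.1, h.2⟩
  · exact ⟨Fin.ext h.1, h.2⟩

lemma winPos_fst_lt {nu ny p f : ℕ} (α : WinIdx nu ny p f) : (winPos α).1 < p + f := by
  rcases α with (⟨i, c⟩ | ⟨i, c⟩) | ⟨i, c⟩ <;> simp [winPos] <;> omega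

/-- Inputs and innovations as one scalar family. -/
def noise {Ω : Type*} (u : RandSeq Ω nu) (e : RandSeq Ω ny) (h : ℕ × (Fin nu ⊕ Fin ny)) (ω : Ω) :
    ℝ :=
  Sum.elim (u h.1 ω) (e h.1 ω) h.2

/-- A vector over `Fin p × Fin n` as a sequence of vectors, continued by zero. -/
def blockSeq {p n : ℕ} (v : Fin p × Fin n → ℝ) (r : ℕ) (c : Fin n) : ℝ :=
  if h : r < p then v (⟨r, h⟩, c) else 0

lemma sum_range_sqNorm_blockSeq {p n : ℕ} (v : Fin p × Fin n → ℝ) :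
    ∑ r ∈ Finset.range p, sqNorm (blockSeq v r) = sqNorm v := by
  simp only [Finset.sum_range, sqNorm, Fintype.sum_prod_type]
  refine Finset.sum_congr rfl fun r _ => Finset.sum_congr rfl fun c _ => ?_
  simp [blockSeq]

lemma sum_range_blockSeq_dotProduct {p n : ℕ} (v : Fin p × Fin n → ℝ) (y : ℕ → Fin n → ℝ) :
    ∑ r ∈ Finset.range p, blockSeq v r ⬝ᵥ y r = ∑ i : Fin p × Fin n, v i * y i.1 i.2 := by
  simp only [Finset.sum_range, dotProduct, Fintype.sum_prod_type]
  refine Finset.sum_congr rfl fun r _ => Finset.sum_congr rfl fun c _ => ?_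
  simp [blockSeq]

lemma sqNorm_sumElim {α β : Type*} [Fintype α] [Fintype β] (a : α ⊕ β → ℝ) :
    sqNorm a = sqNorm (a ∘ Sum.inl) + sqNorm (a ∘ Sum.inr) := by
  simp [sqNorm, Fintype.sum_sum_type]

end Costate

/-! ### Rewriting data weights as weights of independent noises -/

namespace LinSys

variable {nx nu ny : ℕ} (S : LinSys nx nu ny)

lemma isUnit_seSqrt_det (hSe : S.Se.PosDef) : IsUnit S.SeSqrt.det := by
  have h1 : S.SeSqrt * S.SeSqrt = S.Se :=
    CFC.sqrt_mul_sqrt_self S.Se (Matrix.nonneg_iff_posSemidef.2 hSe.posSemidef)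
  have h2 : S.Se.det ≠ 0 := hSe.det_pos.ne'
  rw [← h1, det_mul] at h2
  exact isUnit_iff_ne_zero.2 (left_ne_zero_of_mul h2)

/-- The window weights of innovations and inputs equivalent to given output and input weights. -/
def windowWeights {p f : ℕ} (R : Matrix (Fin ny) (Fin ny) ℝ)
    (v : (Fin p × Fin ny) ⊕ (Fin p × Fin nu) → ℝ)
    (s : Fin f × Fin nu → ℝ) : WinIdx nu ny p f → ℝ :=
  let lam := costate S.A S.C (blockSeq fun i => v (Sum.inl i)) p
  Sum.elim (Sum.elim (fun i => (S.Bᵀ *ᵥ lam (p - 1 - i.1)) i.2 + v (Sum.inr i)) s)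
    fun i => (Rᵀ *ᵥ (S.Kᵀ *ᵥ lam (p - 1 - i.1) + fun c => v (Sum.inl (i.1, c)))) i.2

/-- The matrix mapping window weights to the weight of the initial state. -/
noncomputable def initialWeights (R : Matrix (Fin ny) (Fin ny) ℝ) (p f : ℕ) :
    Matrix (Fin nx) (WinIdx nu ny p f) ℝ :=
  Matrix.of fun b => Sum.elim (fun _ => 0) fun i => (S.AKᵀ ^ (i.1 : ℕ) * (S.Cᵀ * Rᵀ⁻¹)) b i.2

section

variable {p f : ℕ} {R : Matrix (Fin ny) (Fin ny) ℝ}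
  (v : (Fin p × Fin ny) ⊕ (Fin p × Fin nu) → ℝ) (s : Fin f × Fin nu → ℝ)

/-- Inverts the innovation part of `windowWeights`: the output weights come back from the innovation
weights once the costate is known. -/
lemma blockSeq_output_weights (hR : IsUnit R.det) {r : ℕ} (hr : r < p) :
    blockSeq (fun i => v (Sum.inl i)) r
      = Rᵀ⁻¹ *ᵥ blockSeq (fun i => S.windowWeights R v s (Sum.inr i)) r
        - S.Kᵀ *ᵥ costate S.A S.C (blockSeq fun i => v (Sum.inl i)) p (p - 1 - r) := by
  have e : blockSeq (fun i => S.windowWeights R v s (Sum.inr i)) r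
      = Rᵀ *ᵥ (S.Kᵀ *ᵥ costate S.A S.C (blockSeq fun i => v (Sum.inl i)) p (p - 1 - r)
        + blockSeq (fun i => v (Sum.inl i)) r) := by
    funext c
    simp only [blockSeq, hr, dite_true, windowWeights, Sum.elim_inr]
    congr 2
    funext c
    simp [blockSeq, hr]
  rw [e, mulVec_mulVec, nonsing_inv_mul _ (by rwa [det_transpose]), one_mulVec]
  abel

/-- Substituting the recovered output weights into the costate recursion turns Aᵀ into (A - KC)ᵀ,
with the innovation weights as forcing. This is where the predictor matrix, and hence its stability,
enters. -/
lemma costate_succ_eq (hR : IsUnit R.det) {t : ℕ} (ht : t < p) :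
    costate S.A S.C (blockSeq fun i => v (Sum.inl i)) p (t + 1)
      = S.AKᵀ *ᵥ costate S.A S.C (blockSeq fun i => v (Sum.inl i)) p t
        + (S.Cᵀ * Rᵀ⁻¹) *ᵥ blockSeq (fun i => S.windowWeights R v s (Sum.inr i)) (p - 1 - t) := by
  have e : p - 1 - (p - 1 - t) = t := by omega
  rw [costate, S.blockSeq_output_weights v s hR (r := p - 1 - t) (by omega), e]
  simp only [AK, transpose_sub, transpose_mul, sub_mulVec, mulVec_sub, mulVec_mulVec]
  abel

lemma costate_eq_sum (hR : IsUnit R.det) {t : ℕ} (ht : t ≤ p) :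
    costate S.A S.C (blockSeq fun i => v (Sum.inl i)) p t
      = ∑ j ∈ Finset.range t, (S.AKᵀ ^ j * (S.Cᵀ * Rᵀ⁻¹)) *ᵥ
          blockSeq (fun i => S.windowWeights R v s (Sum.inr i)) (p - t + j) := by
  induction t with
  | zero => simp [costate]
  | succ t ih =>
    rw [S.costate_succ_eq v s hR (by omega), ih (by omega), Finset.sum_range_succ', mulVec_sum]
    congr 1
    · refine Finset.sum_congr rfl fun j _ => ?_
      rw [mulVec_mulVec, ← Matrix.mul_assoc, ← pow_succ']
      congr 2; omega
    · simp only [pow_zero, Matrix.one_mul]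
      congr 2; omega

/-- Makes the weight of the initial state a fixed linear function of the window weights, as needed
for the matrix Γ in `IsScalarNoise.exists_sum_sq_forms_ge`. -/
lemma initialWeights_mulVec (hR : IsUnit R.det) :
    S.initialWeights R p f *ᵥ S.windowWeights R v s
      = costate S.A S.C (blockSeq fun i => v (Sum.inl i)) p p := by
  rw [S.costate_eq_sum v s hR le_rfl]
  funext b
  simp only [Finset.sum_apply, mulVec, dotProduct, Finset.sum_range, Nat.sub_self, zero_add]
  rw [Fintype.sum_sum_type, Fintype.sum_prod_type]
  simp [initialWeights, blockSeq]

end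

/-- The weights of the data window control the weights of outputs and inputs and of the initial
state, uniformly in the horizons. -/
lemma exists_windowWeights_bound (hAK : specRad S.AK < 1) {R : Matrix (Fin ny) (Fin ny) ℝ}
    (hR : IsUnit R.det) : ∃ c : ℝ, 0 < c ∧ ∀ (p f : ℕ)
      (v : (Fin p × Fin ny) ⊕ (Fin p × Fin nu) → ℝ) (s : Fin f × Fin nu → ℝ),
      sqNorm v + sqNorm s ≤ c * sqNorm (S.windowWeights R v s) ∧
      sqNorm (S.initialWeights R p f *ᵥ S.windowWeights R v s)
        ≤ c * sqNorm (S.windowWeights R v s) := by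
  obtain ⟨m, η, hm, hη0, hη1, hn⟩ := exists_norm_pow_le_of_specRad_lt_one hAK
  have hn' : ‖S.AKᵀ ^ m‖ ≤ η ^ m := by
    rw [← transpose_pow, ← conjTranspose_eq_transpose_of_trivial, l2_opNorm_conjTranspose]
    exact hn
  obtain ⟨C1, hC1, hsum⟩ := exists_sum_sqNorm_le hm hη0 hη1 hn'
  set c2 := ‖S.Cᵀ * Rᵀ⁻¹‖ ^ 2
  set c3 := ‖Rᵀ⁻¹‖ ^ 2
  set kK := ‖S.Kᵀ‖ ^ 2
  set kB := ‖S.Bᵀ‖ ^ 2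
  have hc2 : 0 ≤ c2 := sq_nonneg _
  have hc3 : 0 ≤ c3 := sq_nonneg _
  have hkK : 0 ≤ kK := sq_nonneg _
  have hkB : 0 ≤ kB := sq_nonneg _
  -- The terms with c3, kK come from `hy`, the term with kB from `hu`, the last C1 * c2 from
  -- `hlamp`; the 3 covers the input weights themselves.
  refine ⟨(2 * c3 + 3) + (2 * kK + 2 * kB + 1) * (C1 * c2), by positivity, fun p f v s => ?_⟩
  set a := S.windowWeights R v s with ha
  set lam := costate S.A S.C (blockSeq fun i => v (Sum.inl i)) p
  set ζ : Fin p × Fin ny → ℝ := fun i => a (Sum.inr i)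
  set α : Fin p × Fin nu → ℝ := fun i => a (Sum.inl (Sum.inl i))
  have hs : (fun i => a (Sum.inl (Sum.inr i))) = s := by
    funext i; simp [ha, windowWeights]
  have hasum : sqNorm a = sqNorm α + sqNorm s + sqNorm ζ := by
    rw [sqNorm_sumElim a, sqNorm_sumElim (a ∘ Sum.inl), ← hs]; rfl
  have hvsum : sqNorm v = sqNorm (fun i => v (Sum.inl i)) + sqNorm (fun i => v (Sum.inr i)) :=
    sqNorm_sumElim v
  have hα0 := sqNorm_nonneg α
  have hζ0 := sqNorm_nonneg ζ
  have hs0 := sqNorm_nonneg s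
  -- The ℓ² bound for stable recursions has a constant free of the number of steps, hence of p.
  have hlam : ∑ t ∈ Finset.range (p + 1), sqNorm (lam t) ≤ C1 * c2 * sqNorm ζ := by
    refine (hsum lam (fun t => (S.Cᵀ * Rᵀ⁻¹) *ᵥ blockSeq ζ (p - 1 - t)) p rfl
      fun t ht => S.costate_succ_eq v s hR ht).trans ?_
    rw [mul_assoc]
    refine mul_le_mul_of_nonneg_left ?_ hC1
    rw [← sum_range_sqNorm_blockSeq ζ, Finset.mul_sum,
      ← Finset.sum_range_reflect (fun r => c2 * sqNorm (blockSeq ζ r))]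
    exact Finset.sum_le_sum fun t _ => sqNorm_mulVec_le _ _
  have hlam' : ∑ r ∈ Finset.range p, sqNorm (lam (p - 1 - r)) ≤ C1 * c2 * sqNorm ζ := by
    rw [Finset.sum_range_reflect (fun r => sqNorm (lam r))]
    rw [Finset.sum_range_succ] at hlam
    have := sqNorm_nonneg (lam p)
    linarith
  have hlamp : sqNorm (lam p) ≤ C1 * c2 * sqNorm ζ := by
    rw [Finset.sum_range_succ] at hlam
    have : 0 ≤ ∑ t ∈ Finset.range p, sqNorm (lam t) :=
      Finset.sum_nonneg fun _ _ => sqNorm_nonneg _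
    linarith
  have hy : sqNorm (fun i => v (Sum.inl i)) ≤ 2 * c3 * sqNorm ζ + 2 * kK * (C1 * c2 * sqNorm ζ) := by
    rw [← sum_range_sqNorm_blockSeq]
    calc _ ≤ ∑ r ∈ Finset.range p,
          (2 * c3 * sqNorm (blockSeq ζ r) + 2 * kK * sqNorm (lam (p - 1 - r))) := by
          refine Finset.sum_le_sum fun r hr => ?_
          rw [S.blockSeq_output_weights v s hR (Finset.mem_range.1 hr), sub_eq_add_neg]
          refine (sqNorm_add_le _ _).trans ?_
          have h1 := sqNorm_mulVec_le Rᵀ⁻¹ (blockSeq ζ r)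
          have h2 := sqNorm_mulVec_le S.Kᵀ (lam (p - 1 - r))
          have h3 : sqNorm (-(S.Kᵀ *ᵥ lam (p - 1 - r))) = sqNorm (S.Kᵀ *ᵥ lam (p - 1 - r)) := by
            simp [sqNorm]
          rw [h3]
          linarith
      _ = 2 * c3 * sqNorm ζ + 2 * kK * ∑ r ∈ Finset.range p, sqNorm (lam (p - 1 - r)) := by
          rw [Finset.sum_add_distrib, ← Finset.mul_sum, ← Finset.mul_sum,
            sum_range_sqNorm_blockSeq]
      _ ≤ _ := by gcongr
  have hu : sqNorm (fun i => v (Sum.inr i)) ≤ 2 * sqNorm α + 2 * kB * (C1 * c2 * sqNorm ζ) := by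
    rw [← sum_range_sqNorm_blockSeq]
    calc _ ≤ ∑ r ∈ Finset.range p,
          (2 * sqNorm (blockSeq α r) + 2 * kB * sqNorm (lam (p - 1 - r))) := by
          refine Finset.sum_le_sum fun r hr => ?_
          have e : blockSeq (fun i => v (Sum.inr i)) r
              = blockSeq α r + -(S.Bᵀ *ᵥ lam (p - 1 - r)) := by
            funext c
            simp [blockSeq, Finset.mem_range.1 hr, α, ha, windowWeights, lam]
          rw [e]
          refine (sqNorm_add_le _ _).trans ?_
          have h2 := sqNorm_mulVec_le S.Bᵀ (lam (p - 1 - r))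
          have h3 : sqNorm (-(S.Bᵀ *ᵥ lam (p - 1 - r))) = sqNorm (S.Bᵀ *ᵥ lam (p - 1 - r)) := by
            simp [sqNorm]
          rw [h3]
          linarith
      _ = 2 * sqNorm α + 2 * kB * ∑ r ∈ Finset.range p, sqNorm (lam (p - 1 - r)) := by
          rw [Finset.sum_add_distrib, ← Finset.mul_sum, ← Finset.mul_sum,
            sum_range_sqNorm_blockSeq]
      _ ≤ _ := by gcongr
  have hD : 0 ≤ C1 * c2 := by positivity
  rw [S.initialWeights_mulVec v s hR, hvsum, hasum]
  have p1 : 0 ≤ C1 * c2 * sqNorm α := by positivity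
  have p2 : 0 ≤ C1 * c2 * sqNorm s := by positivity
  have p3 : 0 ≤ C1 * c2 * sqNorm ζ := by positivity
  constructor
  · nlinarith [mul_nonneg hkK p1, mul_nonneg hkK p2, mul_nonneg hkB p1, mul_nonneg hkB p2,
      mul_nonneg hc3 hα0, mul_nonneg hc3 hs0]
  · change sqNorm (lam p) ≤ _
    nlinarith [mul_nonneg hkK p1, mul_nonneg hkK p2, mul_nonneg hkB p1, mul_nonneg hkB p2,
      mul_nonneg hc3 hα0, mul_nonneg hc3 hs0, mul_nonneg hkK p3, mul_nonneg hkB p3,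
      mul_nonneg hc3 hζ0]

variable {Ω : Type*} (u : RandSeq Ω nu) (e : RandSeq Ω ny)

lemma state_succ {k : ℕ} (hk : 1 ≤ k) (ω : Ω) :
    S.state u e (k + 1) ω
      = S.A *ᵥ S.state u e k ω + (S.B *ᵥ u k ω + (S.K * S.SeSqrt) *ᵥ e k ω) := by
  obtain ⟨k, rfl⟩ := Nat.exists_eq_add_of_le' hk
  rw [← add_assoc]
  rfl

/-- A weighted column of the data matrices in terms of the window of noises and the state at its
start. -/
lemma weighted_column_eq {p f : ℕ} (hSe : S.Se.PosDef)
    (v : (Fin p × Fin ny) ⊕ (Fin p × Fin nu) → ℝ) (s : Fin f × Fin nu → ℝ) {N : ℕ} (ω : Ω)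
    (j : Fin N) :
    ((Zp S u e p N ω)ᵀ *ᵥ v + (Uf u p f N ω)ᵀ *ᵥ s) j
      = (S.initialWeights S.SeSqrt p f *ᵥ S.windowWeights S.SeSqrt v s)
          ⬝ᵥ S.state u e (1 + j) ω
        + ∑ α, S.windowWeights S.SeSqrt v s α * noise u e (1 + j + (winPos α).1, (winPos α).2) ω := by
  have hR := S.isUnit_seSqrt_det hSe
  set lam := costate S.A S.C (blockSeq fun i => v (Sum.inl i)) p
  have hsum := sum_dotProduct_output S.A S.C (blockSeq fun i => v (Sum.inl i)) p
    (fun r => S.state u e (1 + j + r) ω)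
    (fun r => S.B *ᵥ u (1 + j + r) ω + (S.K * S.SeSqrt) *ᵥ e (1 + j + r) ω)
    (fun r => S.state_succ u e (k := 1 + j + r) (by omega) ω)
  rw [S.initialWeights_mulVec v s hR]
  have e1 : ∀ r : Fin p, lam (p - 1 - r) ⬝ᵥ
      (S.B *ᵥ u (1 + j + r) ω + (S.K * S.SeSqrt) *ᵥ e (1 + j + r) ω)
      = ∑ c, (S.Bᵀ *ᵥ lam (p - 1 - r)) c * u (1 + j + r) ω c
        + ∑ c, (S.SeSqrtᵀ *ᵥ (S.Kᵀ *ᵥ lam (p - 1 - r))) c * e (1 + j + r) ω c := by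
    intro r
    rw [dotProduct_add, dotProduct_mulVec, dotProduct_mulVec, ← mulVec_transpose,
      ← mulVec_transpose, transpose_mul, mulVec_mulVec]
    rfl
  have e3 : ∀ r : Fin p, ∑ c, v (Sum.inl (r, c)) * (S.SeSqrt *ᵥ e (1 + j + r) ω) c
      = ∑ c, (S.SeSqrtᵀ *ᵥ fun c => v (Sum.inl (r, c))) c * e (1 + j + r) ω c := by
    intro r
    change (fun c => v (Sum.inl (r, c))) ⬝ᵥ (S.SeSqrt *ᵥ e (1 + j + r) ω) = _ ⬝ᵥ _
    rw [dotProduct_mulVec, mulVec_transpose]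
  rw [sum_range_blockSeq_dotProduct _ (fun r => S.C *ᵥ S.state u e (1 + j + r) ω),
    Finset.sum_range, Finset.sum_congr rfl fun r _ => e1 r] at hsum
  simp only [add_zero] at hsum
  have lhs : ((Zp S u e p N ω)ᵀ *ᵥ v + (Uf u p f N ω)ᵀ *ᵥ s) j
      = (∑ i : Fin p × Fin ny, v (Sum.inl i) * (S.C *ᵥ S.state u e (1 + j + i.1) ω) i.2)
        + (∑ r : Fin p, ∑ c, v (Sum.inl (r, c)) * (S.SeSqrt *ᵥ e (1 + j + r) ω) c)
        + (∑ i : Fin p × Fin nu, v (Sum.inr i) * u (1 + j + i.1) ω i.2)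
        + ∑ i : Fin f × Fin nu, s i * u (1 + j + (p + i.1)) ω i.2 := by
    rw [← Fintype.sum_prod_type' fun r c => v (Sum.inl (r, c)) * (S.SeSqrt *ᵥ e (1 + j + r) ω) c,
      ← Finset.sum_add_distrib]
    simp only [Pi.add_apply, mulVec, dotProduct, transpose_apply, Fintype.sum_sum_type, Zp, Uf,
      hankel, fromRows_apply_inl, fromRows_apply_inr, of_apply, output]
    congr 1
    · congr 1
      · refine Finset.sum_congr rfl fun i _ => ?_
        ring
      · exact Finset.sum_congr rfl fun i _ => mul_comm _ _
    · refine Finset.sum_congr rfl fun i _ => ?_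
      rw [mul_comm, show 1 + p + (j : ℕ) + (i.1 : ℕ) = 1 + j + (p + i.1) by ring]
  rw [lhs, hsum, Finset.sum_congr rfl fun r _ => e3 r]
  simp only [Fintype.sum_sum_type, windowWeights, Sum.elim_inl, Sum.elim_inr, winPos, noise,
    Fintype.sum_prod_type, Finset.sum_add_distrib, mulVec_add, Pi.add_apply, add_mul]
  simp only [lam]
  ring

end LinSys

/-! ### Deterministic bounds for the weighting matrix -/

section Weighting

variable {ι κ : Type*} [Fintype ι] [Fintype κ] {N : ℕ}

lemma sqNorm_mulVec_le_sum_sq (M : Matrix ι κ ℝ) (x : κ → ℝ) :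
    sqNorm (M *ᵥ x) ≤ (∑ i, ∑ j, M i j ^ 2) * sqNorm x := by
  rw [Finset.sum_mul]
  exact Finset.sum_le_sum fun i _ => dotProduct_sq_le (M i) x

lemma dotProduct_mul_transpose_mulVec (M : Matrix ι κ ℝ) (x : ι → ℝ) :
    x ⬝ᵥ ((M * Mᵀ) *ᵥ x) = sqNorm (Mᵀ *ᵥ x) := by
  rw [sqNorm_eq_dotProduct, ← mulVec_mulVec, dotProduct_mulVec, mulVec_transpose]

lemma posDef_mul_transpose {U : Matrix κ (Fin N) ℝ} (h : ∀ s, s ≠ 0 → 0 < sqNorm (Uᵀ *ᵥ s)) :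
    (U * Uᵀ).PosDef := by
  refine Matrix.PosDef.of_dotProduct_mulVec_pos ?_ fun x hx => ?_
  · simp [Matrix.IsHermitian, conjTranspose_eq_transpose_of_trivial]
  · rw [star_trivial, dotProduct_mul_transpose_mulVec]
    exact h x hx

section

variable [DecidableEq κ] {U : Matrix κ (Fin N) ℝ}

lemma transpose_projPerp : (projPerp U)ᵀ = projPerp U := by
  simp [projPerp, transpose_nonsing_inv, Matrix.mul_assoc]

lemma projPerp_mul_self (hU : IsUnit (U * Uᵀ).det) : projPerp U * projPerp U = projPerp U := by
  have h : Uᵀ * (U * Uᵀ)⁻¹ * U * (Uᵀ * (U * Uᵀ)⁻¹ * U) = Uᵀ * (U * Uᵀ)⁻¹ * U := by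
    calc _ = Uᵀ * ((U * Uᵀ)⁻¹ * (U * Uᵀ)) * (U * Uᵀ)⁻¹ * U := by simp only [Matrix.mul_assoc]
      _ = _ := by rw [nonsing_inv_mul _ hU, Matrix.mul_one]
  simp only [projPerp, Matrix.mul_sub, Matrix.sub_mul, Matrix.one_mul, Matrix.mul_one, h]
  abel

lemma sqNorm_projPerp_mulVec_le (hU : IsUnit (U * Uᵀ).det) (y : Fin N → ℝ) :
    sqNorm (projPerp U *ᵥ y) ≤ sqNorm y := by
  have h1 : (projPerp U *ᵥ y) ⬝ᵥ (projPerp U *ᵥ y) = y ⬝ᵥ (projPerp U *ᵥ y) := by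
    rw [dotProduct_mulVec, vecMul_mulVec, transpose_projPerp, projPerp_mul_self hU,
      dotProduct_comm, ← mulVec_transpose, transpose_projPerp]
  have h2 := sqNorm_nonneg (y - projPerp U *ᵥ y)
  rw [sqNorm_eq_dotProduct] at h2 ⊢
  rw [sqNorm_eq_dotProduct]
  simp only [sub_dotProduct, dotProduct_sub] at h2
  have h3 := dotProduct_comm y (projPerp U *ᵥ y)
  linarith

end

/-- Bounds for the square root of a normalized Schur complement. -/
lemma weighting_bounds [DecidableEq ι] [DecidableEq κ] {Z : Matrix ι (Fin N) ℝ} {U : Matrix κ (Fin N) ℝ} {c t : ℝ} (hN : 0 < N)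
    (hc : 0 < c) (ht : 0 ≤ t)
    (h : ∀ v s, c * N * (sqNorm v + sqNorm s) ≤ sqNorm (Zᵀ *ᵥ v + Uᵀ *ᵥ s))
    (hZ : ∑ j, ∑ i, Z i j ^ 2 ≤ N * t) :
    (U * Uᵀ).PosDef ∧ (CFC.sqrt ((1 / (N : ℝ)) • (Z * projPerp U * Zᵀ))).PosDef ∧
      ‖CFC.sqrt ((1 / (N : ℝ)) • (Z * projPerp U * Zᵀ))‖ ≤ √t ∧
      ‖(CFC.sqrt ((1 / (N : ℝ)) • (Z * projPerp U * Zᵀ)))⁻¹‖ ≤ √c⁻¹ := by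
  have hN' : (0 : ℝ) < N := by exact_mod_cast hN
  have hUpd : (U * Uᵀ).PosDef := by
    refine posDef_mul_transpose fun s hs => ?_
    have h1 := h 0 s
    have h2 : 0 < sqNorm s := lt_of_le_of_ne (sqNorm_nonneg s) fun h => hs (sqNorm_eq_zero.1 h.symm)
    simp only [mulVec_zero, zero_add, sqNorm_zero] at h1
    exact lt_of_lt_of_le (by positivity) h1
  have hU : IsUnit (U * Uᵀ).det := isUnit_iff_ne_zero.2 hUpd.det_pos.ne'
  set M := (1 / (N : ℝ)) • (Z * projPerp U * Zᵀ) with hM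
  have hquad : ∀ x, x ⬝ᵥ (M *ᵥ x) = (1 / (N : ℝ)) * sqNorm (projPerp U *ᵥ (Zᵀ *ᵥ x)) := by
    intro x
    have e : Z * projPerp U * Zᵀ = (Z * projPerp U) * (Z * projPerp U)ᵀ := by
      rw [transpose_mul, transpose_projPerp, Matrix.mul_assoc, Matrix.mul_assoc,
        ← Matrix.mul_assoc (projPerp U), projPerp_mul_self hU]
    rw [hM, smul_mulVec, dotProduct_smul, e, dotProduct_mul_transpose_mulVec, transpose_mul,
      transpose_projPerp, mulVec_mulVec, smul_eq_mul]
  have hlow : ∀ x, c * sqNorm x ≤ x ⬝ᵥ (M *ᵥ x) := by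
    intro x
    -- The least-squares choice of s turns Zᵀx + Uᵀs into the projection of Zᵀx.
    have h1 := h x (-((U * Uᵀ)⁻¹ *ᵥ (U *ᵥ (Zᵀ *ᵥ x))))
    have e : Zᵀ *ᵥ x + Uᵀ *ᵥ (-((U * Uᵀ)⁻¹ *ᵥ (U *ᵥ (Zᵀ *ᵥ x)))) = projPerp U *ᵥ (Zᵀ *ᵥ x) := by
      rw [projPerp, sub_mulVec, one_mulVec]
      simp only [mulVec_neg, mulVec_mulVec, Matrix.mul_assoc]
      abel
    rw [e] at h1
    rw [hquad, one_div, ← div_eq_inv_mul, le_div_iff₀ hN']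
    have h2 := sqNorm_nonneg (-((U * Uᵀ)⁻¹ *ᵥ (U *ᵥ (Zᵀ *ᵥ x))))
    have h3 : 0 ≤ c * N := by positivity
    nlinarith [mul_nonneg h3 h2]
  have hupp : ∀ x, x ⬝ᵥ (M *ᵥ x) ≤ t * sqNorm x := by
    intro x
    rw [hquad, one_div, ← div_eq_inv_mul, div_le_iff₀ hN']
    calc _ ≤ sqNorm (Zᵀ *ᵥ x) := sqNorm_projPerp_mulVec_le hU _
      _ ≤ (∑ j, ∑ i, Z i j ^ 2) * sqNorm x := sqNorm_mulVec_le_sum_sq Zᵀ x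
      _ ≤ N * t * sqNorm x := mul_le_mul_of_nonneg_right hZ (sqNorm_nonneg x)
      _ = _ := by ring
  have hMpsd : M.PosSemidef := by
    refine Matrix.PosSemidef.of_dotProduct_mulVec_nonneg ?_ fun x => ?_
    · rw [Matrix.IsHermitian, conjTranspose_eq_transpose_of_trivial, hM]
      simp [transpose_projPerp, Matrix.mul_assoc]
    · rw [star_trivial]
      exact (mul_nonneg hc.le (sqNorm_nonneg x)).trans (hlow x)
  set W := CFC.sqrt M with hW
  have hWW : W * W = M := CFC.sqrt_mul_sqrt_self M (Matrix.nonneg_iff_posSemidef.2 hMpsd)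
  have hWpsd : W.PosSemidef := Matrix.nonneg_iff_posSemidef.1 (CFC.sqrt_nonneg M)
  have hWT : Wᵀ = W := by
    rw [← conjTranspose_eq_transpose_of_trivial]; exact hWpsd.isHermitian
  have hWsq : ∀ x, sqNorm (W *ᵥ x) = x ⬝ᵥ (M *ᵥ x) := by
    intro x
    have := dotProduct_mul_transpose_mulVec W x
    rw [hWT, hWW] at this
    exact this.symm
  have hWunit : IsUnit W := by
    rw [← Matrix.mulVec_injective_iff_isUnit]
    intro x y hxy
    have h1 : W *ᵥ (x - y) = 0 := by rw [mulVec_sub, sub_eq_zero]; exact hxy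
    have h2 := hlow (x - y)
    rw [← hWsq, h1, sqNorm_zero] at h2
    have h3 : sqNorm (x - y) = 0 := by nlinarith [sqNorm_nonneg (x - y)]
    exact sub_eq_zero.1 (sqNorm_eq_zero.1 h3)
  refine ⟨hUpd, hWpsd.posDef_iff_isUnit.2 hWunit, ?_, ?_⟩
  · exact norm_le_of_sqNorm_mulVec_le ht fun x => (hWsq x).trans_le (hupp x)
  · refine norm_le_of_sqNorm_mulVec_le (by positivity) fun x => ?_
    -- At W⁻¹x the quadratic form of M = W² equals |x|².
    have h1 := hlow (W⁻¹ *ᵥ x)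
    rw [← hWsq, mulVec_mulVec, mul_nonsing_inv _ ((isUnit_iff_isUnit_det W).1 hWunit),
      one_mulVec] at h1
    rwa [inv_mul_eq_div, le_div_iff₀ hc, mul_comm]

end Weighting

/-! ### Independent scalar noises and second moments of sums of products -/

section ScalarNoise

variable {Ω : Type*} {mΩ : MeasurableSpace Ω} {μ : Measure Ω}

lemma iIndepFun_sumElim {α β E : Type*} [MeasurableSpace E] {X : α → Ω → E} {Y : β → Ω → E}
    (hX : iIndepFun X μ) (hY : iIndepFun Y μ)
    (hXY : IndepFun (fun ω i => X i ω) (fun ω j => Y j ω) μ) :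
    iIndepFun (fun i : α ⊕ β => Sum.elim X Y i) μ := by
  rw [iIndepFun_iff_measure_inter_preimage_eq_mul] at hX hY ⊢
  intro s A hA
  rw [← Finset.toLeft_disjSum_toRight (u := s), Finset.prod_disjSum]
  have hA1 : ∀ i ∈ s.toLeft, MeasurableSet (A (Sum.inl i)) := fun i hi =>
    hA _ (Finset.mem_toLeft.1 hi)
  have hA2 : ∀ i ∈ s.toRight, MeasurableSet (A (Sum.inr i)) := fun i hi =>
    hA _ (Finset.mem_toRight.1 hi)
  have e : (⋂ i ∈ s.toLeft.disjSum s.toRight, Sum.elim X Y i ⁻¹' A i)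
      = (fun ω i => X i ω) ⁻¹' (⋂ i ∈ s.toLeft, (fun x => x i) ⁻¹' A (Sum.inl i))
        ∩ (fun ω i => Y i ω) ⁻¹' (⋂ i ∈ s.toRight, (fun x => x i) ⁻¹' A (Sum.inr i)) := by
    ext ω
    simp
  rw [e, hXY.measure_inter_preimage_eq_mul _ _
    (Finset.measurableSet_biInter _ fun i hi => measurable_pi_apply i (hA1 i hi))
    (Finset.measurableSet_biInter _ fun i hi => measurable_pi_apply i (hA2 i hi))]
  simp only [Sum.elim_inl, Sum.elim_inr]
  rw [← hX s.toLeft hA1, ← hY s.toRight hA2]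
  simp only [Set.preimage_iInter]
  rfl

/-- A family of independent centred Gaussian scalars, indexed by time and channel, with
variances depending on the channel. -/
structure IsScalarNoise {κ : Type*} (μ : Measure Ω) (ξ : ℕ × κ → Ω → ℝ) (v : κ → NNReal) :
    Prop where
  measurable : ∀ h, Measurable (ξ h)
  indep : iIndepFun ξ μ
  law : ∀ h, μ.map (ξ h) = gaussianReal 0 (v h.2)

lemma IsGaussianWhiteNoise.map_apply {n : ℕ} {s : RandSeq Ω n} {v : ℝ}
    (h : IsGaussianWhiteNoise μ s v) (k : ℕ) (c : Fin n) :
    μ.map (fun ω => s k ω c) = gaussianReal 0 v.toNNReal := by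
  have e : (fun ω => s k ω c) = (fun x : Fin n → ℝ => x c) ∘ s k := rfl
  rw [e, ← Measure.map_map (measurable_pi_apply c) (h.1 k), h.2.1 k]
  exact (measurePreserving_eval (fun _ : Fin n => gaussianReal 0 v.toNNReal) c).map_eq

lemma IsGaussianWhiteNoise.iIndepFun_scalars [IsProbabilityMeasure μ] {n : ℕ} {s : RandSeq Ω n}
    {v : ℝ} (h : IsGaussianWhiteNoise μ s v) :
    iIndepFun (fun (i : ℕ × Fin n) ω => s i.1 ω i.2) μ := by
  have hm : ∀ k c, Measurable fun ω => s k ω c := fun k c =>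
    (measurable_pi_apply c).comp (h.1 k)
  refine iIndepFun_uncurry' (X := fun k c ω => s k ω c) hm h.2.2 fun k => ?_
  rw [iIndepFun_iff_map_fun_eq_pi_map fun c => (hm k c).aemeasurable]
  simp_rw [h.map_apply]
  exact h.2.1 k

lemma isScalarNoise_noise [IsProbabilityMeasure μ] {nu ny : ℕ} {u : RandSeq Ω nu}
    {e : RandSeq Ω ny} {s t : ℝ} (hu : IsGaussianWhiteNoise μ u s)
    (he : IsGaussianWhiteNoise μ e t)
    (hue : IndepFun (fun ω k => u k ω) (fun ω k => e k ω) μ) :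
    IsScalarNoise μ (noise u e) (Sum.elim (fun _ => s.toNNReal) fun _ => t.toNNReal) where
  measurable := by
    rintro ⟨k, c | c⟩
    · exact (measurable_pi_apply c).comp (hu.1 k)
    · exact (measurable_pi_apply c).comp (he.1 k)
  indep := by
    have hi : IndepFun (fun ω (i : ℕ × Fin nu) => u i.1 ω i.2)
        (fun ω (i : ℕ × Fin ny) => e i.1 ω i.2) μ :=
      hue.comp (φ := fun (x : ℕ → Fin nu → ℝ) (i : ℕ × Fin nu) => x i.1 i.2)
        (ψ := fun (x : ℕ → Fin ny → ℝ) (i : ℕ × Fin ny) => x i.1 i.2) (by fun_prop) (by fun_prop)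
    have h := iIndepFun_sumElim hu.iIndepFun_scalars he.iIndepFun_scalars hi
    have h2 := h.precomp (g := fun i : ℕ × (Fin nu ⊕ Fin ny) =>
      Sum.map (fun c => (i.1, c)) (fun c => (i.1, c)) i.2) (by
        rintro ⟨j, c | c⟩ ⟨k, d | d⟩ hjk <;> simp_all)
    convert h2 using 1
    funext ⟨k, c⟩
    rcases c with c | c <;> rfl
  law := by
    rintro ⟨k, c | c⟩
    · exact hu.map_apply k c
    · exact he.map_apply k c

section

variable {κ : Type*} (ξ : ℕ × κ → Ω → ℝ)

/-- The σ-algebra generated by all noise variables but one. -/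
abbrev others (h : ℕ × κ) : MeasurableSpace Ω :=
  ⨆ j ∈ ({h}ᶜ : Set (ℕ × κ)), MeasurableSpace.comap (ξ j) inferInstance

/-- The σ-algebra generated by the noise variables before time `k`. -/
abbrev past (k : ℕ) : MeasurableSpace Ω :=
  ⨆ j ∈ {j : ℕ × κ | j.1 < k}, MeasurableSpace.comap (ξ j) inferInstance

variable {ξ}

lemma measurable_others {h j : ℕ × κ} (hj : j ≠ h) : Measurable[others ξ h] (ξ j) :=
  (comap_measurable (ξ j)).mono
    (le_iSup₂ (f := fun j (_ : j ∈ ({h}ᶜ : Set (ℕ × κ))) =>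
      MeasurableSpace.comap (ξ j) inferInstance) j hj) le_rfl

lemma measurable_past {j : ℕ × κ} {k : ℕ} (hj : j.1 < k) : Measurable[past ξ k] (ξ j) :=
  (comap_measurable (ξ j)).mono
    (le_iSup₂ (f := fun j (_ : j ∈ {j : ℕ × κ | j.1 < k}) =>
      MeasurableSpace.comap (ξ j) inferInstance) j hj) le_rfl

lemma past_mono : Monotone (past ξ) := fun _ _ hkl =>
  biSup_mono fun _ hj => lt_of_lt_of_le hj hkl

lemma past_le_others {h : ℕ × κ} {k : ℕ} (hk : k ≤ h.1) : past ξ k ≤ others ξ h :=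
  biSup_mono fun j hj hjh => by
    have h1 : j.1 < k := hj
    rw [hjh] at h1
    omega

variable {v : κ → NNReal}

lemma IsScalarNoise.others_le (hξ : IsScalarNoise μ ξ v) (h : ℕ × κ) : others ξ h ≤ mΩ :=
  iSup₂_le fun j _ => (hξ.measurable j).comap_le

lemma IsScalarNoise.past_le (hξ : IsScalarNoise μ ξ v) (k : ℕ) : past ξ k ≤ mΩ :=
  iSup₂_le fun j _ => (hξ.measurable j).comap_le

lemma IsScalarNoise.indepFun_others (hξ : IsScalarNoise μ ξ v) {E : Type*} [MeasurableSpace E]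
    {h : ℕ × κ} {Y : Ω → E} (hY : Measurable[others ξ h] Y) : IndepFun (ξ h) Y μ := by
  rw [IndepFun_iff_Indep]
  have h1 := indep_iSup_of_disjoint (fun j => (hξ.measurable j).comap_le) hξ.indep.iIndep
    (S := {h}) (T := {h}ᶜ) disjoint_compl_right
  refine indep_of_indep_of_le_left (indep_of_indep_of_le_right h1 hY.comap_le) ?_
  exact le_iSup₂ (f := fun j (_ : j ∈ ({h} : Set (ℕ × κ))) =>
      MeasurableSpace.comap (ξ j) inferInstance) h rfl

/-! ### Moments -/

lemma IsScalarNoise.integral_comp (hξ : IsScalarNoise μ ξ v) (h : ℕ × κ) {φ : ℝ → ℝ}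
    (hφ : Measurable φ) : ∫ ω, φ (ξ h ω) ∂μ = ∫ x, φ x ∂gaussianReal 0 (v h.2) := by
  rw [← hξ.law h, integral_map (hξ.measurable h).aemeasurable hφ.aestronglyMeasurable]

lemma IsScalarNoise.memLp_comp (hξ : IsScalarNoise μ ξ v) (h : ℕ × κ) {φ : ℝ → ℝ}
    (hφ : Measurable φ) {q : ENNReal} (hq : MemLp φ q (gaussianReal 0 (v h.2))) :
    MemLp (fun ω => φ (ξ h ω)) q μ := by
  rw [← hξ.law h] at hq
  exact (memLp_map_measure_iff hφ.aestronglyMeasurable (hξ.measurable h).aemeasurable).1 hq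

lemma memLp_sq_sub_gaussianReal (v : NNReal) :
    MemLp (fun x : ℝ => x ^ 2 - v) 2 (gaussianReal 0 v) := by
  refine MemLp.sub ?_ (memLp_const _)
  rw [memLp_two_iff_integrable_sq (by fun_prop)]
  have h := (memLp_id_gaussianReal (μ := 0) (v := v) 4).integrable_norm_pow (by norm_num)
  refine h.congr (Filter.Eventually.of_forall fun x => ?_)
  simp only [id, Real.norm_eq_abs]
  rw [← pow_mul]
  exact Even.pow_abs (by decide) x

lemma integral_sq_gaussianReal (v : NNReal) : ∫ x, x ^ 2 ∂gaussianReal 0 v = v := by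
  have h := variance_fun_id_gaussianReal (μ := 0) (v := v)
  rw [variance_eq_integral (by fun_prop)] at h
  simpa using h

lemma IsScalarNoise.memLp_two (hξ : IsScalarNoise μ ξ v) (h : ℕ × κ) : MemLp (ξ h) 2 μ :=
  hξ.memLp_comp h measurable_id (memLp_id_gaussianReal 2)

lemma IsScalarNoise.integral_eq_zero (hξ : IsScalarNoise μ ξ v) (h : ℕ × κ) :
    ∫ ω, ξ h ω ∂μ = 0 :=
  (hξ.integral_comp h measurable_id).trans integral_id_gaussianReal

lemma IsScalarNoise.integral_sq (hξ : IsScalarNoise μ ξ v) (h : ℕ × κ) :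
    ∫ ω, ξ h ω ^ 2 ∂μ = v h.2 :=
  (hξ.integral_comp h (φ := fun x => x ^ 2) (by fun_prop)).trans (integral_sq_gaussianReal _)

lemma IsScalarNoise.memLp_sq_sub (hξ : IsScalarNoise μ ξ v) (h : ℕ × κ) :
    MemLp (fun ω => ξ h ω ^ 2 - v h.2) 2 μ :=
  hξ.memLp_comp h (φ := fun x => x ^ 2 - v h.2) (by fun_prop) (memLp_sq_sub_gaussianReal _)

lemma IsScalarNoise.integral_sq_sub (hξ : IsScalarNoise μ ξ v) [IsProbabilityMeasure μ]
    (h : ℕ × κ) : ∫ ω, (ξ h ω ^ 2 - v h.2) ∂μ = 0 := by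
  rw [integral_sub (hξ.memLp_two h).integrable_sq (integrable_const _), hξ.integral_sq]
  simp

/-- The laws depend only on the channel and there are finitely many channels, so summing over
channels bounds all moments at once. -/
lemma IsScalarNoise.exists_moment_bound [Fintype κ] (hξ : IsScalarNoise μ ξ v) :
    ∃ B : ℝ, 0 ≤ B ∧ (∀ c, (v c : ℝ) ≤ B) ∧
      ∀ h : ℕ × κ, ∫ ω, (ξ h ω ^ 2 - v h.2) ^ 2 ∂μ ≤ B := by
  have h0 : ∀ c, 0 ≤ ∫ x, (x ^ 2 - (v c : ℝ)) ^ 2 ∂gaussianReal 0 (v c) := fun c =>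
    integral_nonneg fun _ => sq_nonneg _
  have hle : ∀ c, (v c : ℝ) + ∫ x, (x ^ 2 - (v c : ℝ)) ^ 2 ∂gaussianReal 0 (v c)
      ≤ ∑ c, ((v c : ℝ) + ∫ x, (x ^ 2 - (v c : ℝ)) ^ 2 ∂gaussianReal 0 (v c)) := fun c =>
    Finset.single_le_sum (f := fun c => (v c : ℝ) + ∫ x, (x ^ 2 - (v c : ℝ)) ^ 2 ∂gaussianReal 0 (v c))
      (fun c _ => add_nonneg (v c).2 (h0 c)) (Finset.mem_univ c)
  refine ⟨_, Finset.sum_nonneg fun c _ => add_nonneg (v c).2 (h0 c),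
    fun c => le_trans ?_ (hle c), fun h => ?_⟩
  · linarith [h0 c]
  · rw [hξ.integral_comp h (φ := fun x => (x ^ 2 - v h.2) ^ 2) (by fun_prop)]
    have h1 : (0 : ℝ) ≤ v h.2 := (v h.2).2
    refine le_trans ?_ (hle h.2)
    linarith

/-! ### Sums of orthogonal increments -/

/-- Each increment is orthogonal to the preceding partial sum, so the variances add. -/
lemma integral_sum_sq_le {D : ℕ → Ω → ℝ} {B : ℝ} (hD : ∀ k, MemLp (D k) 2 μ)
    (horth : ∀ k, ∫ ω, (∑ j ∈ Finset.range k, D j ω) * D k ω ∂μ = 0)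
    (hB : ∀ k, ∫ ω, D k ω ^ 2 ∂μ ≤ B) (N : ℕ) :
    ∫ ω, (∑ k ∈ Finset.range N, D k ω) ^ 2 ∂μ ≤ N * B := by
  have hS : ∀ k, MemLp (fun ω => ∑ j ∈ Finset.range k, D j ω) 2 μ := fun k =>
    memLp_finsetSum _ fun j _ => hD j
  induction N with
  | zero => simp
  | succ N ih =>
    have e : (fun ω => (∑ k ∈ Finset.range (N + 1), D k ω) ^ 2)
        = (fun ω => (∑ k ∈ Finset.range N, D k ω) ^ 2)
          + (fun ω => 2 * ((∑ k ∈ Finset.range N, D k ω) * D N ω)) + fun ω => D N ω ^ 2 := by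
      funext ω
      simp only [Finset.sum_range_succ, Pi.add_apply]
      ring
    have i1 := (hS N).integrable_sq
    have i2 : Integrable (fun ω => 2 * ((∑ k ∈ Finset.range N, D k ω) * D N ω)) μ :=
      ((hS N).integrable_mul (hD N)).const_mul 2
    rw [e, integral_add' (i1.add i2) (hD N).integrable_sq, integral_add' i1 i2, integral_const_mul,
      horth N]
    push_cast
    linarith [hB N]

/-- The second moment of a sum of products `φ (ξ (h k)) * Y k`, each first factor being centred and
independent of the second factor and of the earlier products. -/
lemma IsScalarNoise.integral_sum_mul_sq_le (hξ : IsScalarNoise μ ξ v) {φ : ℝ → ℝ}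
    (hφ : Measurable φ) {h : ℕ → ℕ × κ} {Y : ℕ → Ω → ℝ} {B₁ B₂ : ℝ} (hB₁ : 0 ≤ B₁)
    (h0 : ∀ k, ∫ ω, φ (ξ (h k) ω) ∂μ = 0) (h2 : ∀ k, MemLp (fun ω => φ (ξ (h k) ω)) 2 μ)
    (hφB : ∀ k, ∫ ω, φ (ξ (h k) ω) ^ 2 ∂μ ≤ B₁)
    (hY : ∀ k, Measurable[others ξ (h k)] (Y k)) (hY2 : ∀ k, MemLp (Y k) 2 μ)
    (hYB : ∀ k, ∫ ω, Y k ω ^ 2 ∂μ ≤ B₂)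
    (hpast : ∀ k, ∀ j < k, Measurable[others ξ (h k)] fun ω => φ (ξ (h j) ω) * Y j ω) (N : ℕ) :
    Integrable (fun ω => (∑ k ∈ Finset.range N, φ (ξ (h k) ω) * Y k ω) ^ 2) μ ∧
    ∫ ω, (∑ k ∈ Finset.range N, φ (ξ (h k) ω) * Y k ω) ^ 2 ∂μ ≤ N * (B₁ * B₂) := by
  have hind : ∀ k, IndepFun (fun ω => φ (ξ (h k) ω) ^ 2) (fun ω => Y k ω ^ 2) μ := fun k =>
    (hξ.indepFun_others (hY k)).comp (φ := fun x => φ x ^ 2) (ψ := fun y => y ^ 2)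
      (by fun_prop) (by fun_prop)
  have hmφ : ∀ k, Measurable fun ω => φ (ξ (h k) ω) := fun k => hφ.comp (hξ.measurable _)
  have hmY : ∀ k, Measurable (Y k) := fun k => (hY k).mono (hξ.others_le _) le_rfl
  have hD : ∀ k, MemLp (fun ω => φ (ξ (h k) ω) * Y k ω) 2 μ := by
    intro k
    refine (memLp_two_iff_integrable_sq ((hmφ k).mul (hmY k)).aestronglyMeasurable).2 ?_
    exact ((hind k).integrable_mul (h2 k).integrable_sq (hY2 k).integrable_sq).congr
      (Filter.Eventually.of_forall fun ω => by simp [mul_pow])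
  refine ⟨(memLp_finsetSum _ fun j _ => hD j).integrable_sq,
    integral_sum_sq_le hD (fun k => ?_) (fun k => ?_) N⟩
  -- The earlier products times Y k avoid the variable ξ (h k), so the centred factor splits off and
  -- the expectation vanishes. Leaving out one variable, rather than conditioning on the past,
  -- allows Y k to contain noises of the same time.
  · have hm : Measurable[others ξ (h k)] fun ω =>
        (∑ j ∈ Finset.range k, φ (ξ (h j) ω) * Y j ω) * Y k ω :=
      (Finset.measurable_fun_sum _ fun j hj => hpast k j (Finset.mem_range.1 hj)).mul (hY k)
    have hi := (hξ.indepFun_others hm).comp (φ := φ) (ψ := id) hφ measurable_id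
    have e := hi.integral_fun_mul_eq_mul_integral (hmφ k).aestronglyMeasurable
      (hm.mono (hξ.others_le _) le_rfl).aestronglyMeasurable
    simp only [Function.comp_def, id] at e
    rw [h0 k, zero_mul] at e
    rw [← e]
    exact integral_congr_ae (Filter.Eventually.of_forall fun ω => by ring)
  · simp_rw [mul_pow]
    rw [(hind k).integral_fun_mul_eq_mul_integral
      ((hmφ k).pow_const 2).aestronglyMeasurable ((hmY k).pow_const 2).aestronglyMeasurable]
    exact mul_le_mul (hφB k) (hYB k) (integral_nonneg fun _ => sq_nonneg _) hB₁

end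

end ScalarNoise

/-! ### Sums of squares of linear forms and empirical moments -/

section Gram

variable {J ι : Type*} [Fintype J] [Fintype ι]

lemma abs_sum_mul_mul_le {a : J → ℝ} {b : ι → ℝ} {F : J → ι → ℝ} {R : ℝ} (hR : 0 ≤ R)
    (hF : ∑ i, ∑ j, F i j ^ 2 ≤ R ^ 2) :
    |∑ i, ∑ j, a i * b j * F i j| ≤ R * √(sqNorm a * sqNorm b) := by
  refine abs_le_of_sq_le_sq ?_ (by positivity)
  rw [mul_pow, Real.sq_sqrt (mul_nonneg (sqNorm_nonneg a) (sqNorm_nonneg b))]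
  have h := Finset.sum_mul_sq_le_sq_mul_sq Finset.univ (fun p : J × ι => a p.1 * b p.2)
    (fun p => F p.1 p.2)
  simp only [Fintype.sum_prod_type] at h
  have e : ∑ i, ∑ j, (a i * b j) ^ 2 = sqNorm a * sqNorm b := by
    simp [sqNorm, Finset.sum_mul_sum, mul_pow]
  rw [e] at h
  calc _ ≤ _ := h
    _ ≤ sqNorm a * sqNorm b * R ^ 2 :=
      mul_le_mul_of_nonneg_left hF (mul_nonneg (sqNorm_nonneg a) (sqNorm_nonneg b))
    _ = _ := by ring

/-- A lower bound for a sum of squares of linear forms, in terms of the deviations of the empirical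
second moments. -/
lemma sum_sq_forms_ge [DecidableEq J] {N : ℕ} {g : J → ℕ → ℝ} {x : ℕ → ι → ℝ} {v : J → ℝ} {v₀ R : ℝ}
    (hR : 0 ≤ R) (hv : ∀ α, v₀ ≤ v α)
    (h1 : ∑ α, ∑ β, (∑ k ∈ Finset.range N, (g α k * g β k - if α = β then v α else 0)) ^ 2
      ≤ R ^ 2)
    (h2 : ∑ α, ∑ i, (∑ k ∈ Finset.range N, g α k * x k i) ^ 2 ≤ R ^ 2) (a : J → ℝ) (b : ι → ℝ) :
    (N * v₀ - R) * sqNorm a - 2 * R * √(sqNorm a * sqNorm b)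
      ≤ ∑ k ∈ Finset.range N, (b ⬝ᵥ x k + ∑ α, a α * g α k) ^ 2 := by
  have e1 : ∑ k ∈ Finset.range N, (∑ α, a α * g α k) ^ 2
      = N * ∑ α, v α * a α ^ 2 + ∑ α, ∑ β, a α * a β *
          ∑ k ∈ Finset.range N, (g α k * g β k - if α = β then v α else 0) := by
    have e : ∀ α β, a α * a β * ∑ k ∈ Finset.range N, (g α k * g β k - if α = β then v α else 0)
        = ∑ k ∈ Finset.range N, (a α * g α k) * (a β * g β k)
          - N * if α = β then v α * a α ^ 2 else 0 := by
      intro α β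
      rw [Finset.sum_sub_distrib, mul_sub, Finset.mul_sum]
      congr 1
      · exact Finset.sum_congr rfl fun k _ => by ring
      · split_ifs with hαβ
        · subst hαβ
          simp; ring
        · simp
    simp_rw [e, Finset.sum_sub_distrib, ← Finset.mul_sum, Finset.sum_ite_eq, Finset.mem_univ,
      if_true]
    have e' : ∑ α, ∑ β, ∑ k ∈ Finset.range N, a α * g α k * (a β * g β k)
        = ∑ k ∈ Finset.range N, (∑ α, a α * g α k) ^ 2 := by
      simp_rw [sq, Finset.sum_mul_sum]
      rw [Finset.sum_congr rfl fun α _ => Finset.sum_comm, Finset.sum_comm]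
    rw [e']
    ring
  have e2 : ∑ k ∈ Finset.range N, (b ⬝ᵥ x k) * (∑ α, a α * g α k)
      = ∑ α, ∑ i, a α * b i * ∑ k ∈ Finset.range N, g α k * x k i := by
    simp_rw [dotProduct, Finset.sum_mul_sum, Finset.mul_sum]
    rw [Finset.sum_comm]
    rw [Finset.sum_congr rfl fun i _ => Finset.sum_comm, Finset.sum_comm]
    exact Finset.sum_congr rfl fun α _ => Finset.sum_congr rfl fun i _ =>
      Finset.sum_congr rfl fun k _ => by ring
  have b1 := abs_le.1 (abs_sum_mul_mul_le (a := a) (b := a) hR h1)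
  have b2 := abs_le.1 (abs_sum_mul_mul_le (a := a) (b := b) hR h2)
  rw [Real.sqrt_mul_self (sqNorm_nonneg a)] at b1
  have b3 : v₀ * sqNorm a ≤ ∑ α, v α * a α ^ 2 := by
    rw [sqNorm, Finset.mul_sum]
    exact Finset.sum_le_sum fun α _ => mul_le_mul_of_nonneg_right (hv α) (sq_nonneg _)
  have b4 : (N : ℝ) * (v₀ * sqNorm a) ≤ N * ∑ α, v α * a α ^ 2 :=
    mul_le_mul_of_nonneg_left b3 (Nat.cast_nonneg N)
  -- The square of the state term is dropped, so no lower bound on the state covariance is needed.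
  have b5 : ∑ k ∈ Finset.range N, (∑ α, a α * g α k) ^ 2
      + 2 * ∑ k ∈ Finset.range N, (b ⬝ᵥ x k) * (∑ α, a α * g α k)
      ≤ ∑ k ∈ Finset.range N, (b ⬝ᵥ x k + ∑ α, a α * g α k) ^ 2 := by
    rw [Finset.mul_sum, ← Finset.sum_add_distrib]
    exact Finset.sum_le_sum fun k _ => by nlinarith [sq_nonneg (b ⬝ᵥ x k)]
  rw [e1, e2] at b5
  linarith [b1.1, b2.1]

end Gram

/-! ### Concentration of the empirical moments of a window -/

section Concentration

variable {Ω : Type*} {mΩ : MeasurableSpace Ω} {μ : Measure Ω} {κ : Type*}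
  {ξ : ℕ × κ → Ω → ℝ} {v : κ → NNReal}

/-- The noise variable at time `t` and window position `h`. -/
def shiftNoise (ξ : ℕ × κ → Ω → ℝ) (h : ℕ × κ) (t : ℕ) (ω : Ω) : ℝ := ξ (t + h.1, h.2) ω

lemma IsScalarNoise.window_offdiag (hξ : IsScalarNoise μ ξ v) {B : ℝ} (hB : 0 ≤ B)
    (hvB : ∀ c, (v c : ℝ) ≤ B) {h h' : ℕ × κ} (hne : h ≠ h') (N : ℕ) :
    Integrable (fun ω => (∑ k ∈ Finset.range N,
      shiftNoise ξ h (1 + k) ω * shiftNoise ξ h' (1 + k) ω) ^ 2) μ ∧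
    ∫ ω, (∑ k ∈ Finset.range N, shiftNoise ξ h (1 + k) ω * shiftNoise ξ h' (1 + k) ω) ^ 2 ∂μ
      ≤ N * (B * B) := by
  -- The later of the two noises plays the centred factor: earlier products then involve only
  -- strictly earlier times.
  wlog hle : h'.1 ≤ h.1 generalizing h h'
  · have := this hne.symm (by omega)
    simpa only [mul_comm] using this
  refine hξ.integral_sum_mul_sq_le (φ := id) measurable_id (h := fun k => (1 + k + h.1, h.2))
    (Y := fun k => ξ (1 + k + h'.1, h'.2)) hB (fun k => hξ.integral_eq_zero _)
    (fun k => hξ.memLp_two _) (fun k => ?_) (fun k => ?_) (fun k => hξ.memLp_two _)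
    (fun k => ?_) (fun k j hjk => ?_) N
  · exact (hξ.integral_sq _).trans_le (hvB _)
  · refine measurable_others fun he => hne ?_
    simp only [Prod.mk.injEq, Nat.add_left_cancel_iff] at he
    exact Prod.ext he.1.symm he.2.symm
  · exact (hξ.integral_sq _).trans_le (hvB _)
  · refine Measurable.mul (measurable_others fun he => ?_) (measurable_others fun he => ?_) <;>
    · have := (Prod.mk.injEq _ _ _ _ ▸ he).1
      omega

lemma IsScalarNoise.window_diag [IsProbabilityMeasure μ] (hξ : IsScalarNoise μ ξ v) {B : ℝ}
    (hB : 0 ≤ B) (hvB : ∀ h : ℕ × κ, ∫ ω, (ξ h ω ^ 2 - v h.2) ^ 2 ∂μ ≤ B) (h : ℕ × κ) (N : ℕ) :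
    Integrable (fun ω => (∑ k ∈ Finset.range N,
      (shiftNoise ξ h (1 + k) ω * shiftNoise ξ h (1 + k) ω - v h.2)) ^ 2) μ ∧
    ∫ ω, (∑ k ∈ Finset.range N,
      (shiftNoise ξ h (1 + k) ω * shiftNoise ξ h (1 + k) ω - v h.2)) ^ 2 ∂μ ≤ N * B := by
  have key := hξ.integral_sum_mul_sq_le (φ := fun y => y ^ 2 - v h.2) (by fun_prop)
    (h := fun k => (1 + k + h.1, h.2))
    (Y := fun _ _ => 1) hB (B₂ := 1) (fun k => hξ.integral_sq_sub (1 + k + h.1, h.2))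
    (fun k => hξ.memLp_sq_sub (1 + k + h.1, h.2)) (fun k => hvB (1 + k + h.1, h.2))
    (fun k => measurable_const) (fun k => memLp_const 1)
    (fun k => by simp) (fun k j hjk => ?_) N
  · simpa only [mul_one, sq, shiftNoise] using key
  · refine Measurable.mul (Measurable.sub_const (Measurable.pow_const
      (measurable_others fun he => ?_) 2) _) measurable_const
    have := (Prod.mk.injEq _ _ _ _ ▸ he).1
    omega

lemma IsScalarNoise.window_state (hξ : IsScalarNoise μ ξ v) {B Bx : ℝ}
    (hB : 0 ≤ B) (hvB : ∀ c, (v c : ℝ) ≤ B) {y : ℕ → Ω → ℝ}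
    (hy : ∀ k, Measurable[past ξ k] (y k)) (hy2 : ∀ k, MemLp (y k) 2 μ)
    (hyB : ∀ k, ∫ ω, y k ω ^ 2 ∂μ ≤ Bx) (h : ℕ × κ) (N : ℕ) :
    Integrable (fun ω => (∑ k ∈ Finset.range N, shiftNoise ξ h (1 + k) ω * y (1 + k) ω) ^ 2) μ ∧
    ∫ ω, (∑ k ∈ Finset.range N, shiftNoise ξ h (1 + k) ω * y (1 + k) ω) ^ 2 ∂μ
      ≤ N * (B * Bx) := by
  refine hξ.integral_sum_mul_sq_le (φ := id) measurable_id (h := fun k => (1 + k + h.1, h.2))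
    (Y := fun k => y (1 + k)) hB (fun k => hξ.integral_eq_zero _)
    (fun k => hξ.memLp_two _) (fun k => (hξ.integral_sq _).trans_le (hvB _))
    (fun k => (hy (1 + k)).mono (past_le_others (by simp)) le_rfl) (fun k => hy2 _)
    (fun k => hyB _) (fun k j hjk => ?_) N
  refine Measurable.mul (measurable_others fun he => ?_)
    ((hy (1 + j)).mono (past_le_others (by simp only; omega)) le_rfl)
  have := (Prod.mk.injEq _ _ _ _ ▸ he).1
  omega

/-- With the second moments of the states bounded, weighted sums of squares of window forms are
bounded below outside an event of probability of order `d² / N`. -/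
lemma IsScalarNoise.measure_window_le [IsProbabilityMeasure μ] [Fintype κ]
    (hξ : IsScalarNoise μ ξ v) {n : ℕ} {Bx : ℝ} {x : ℕ → Ω → Fin n → ℝ}
    (hx : ∀ k b, Measurable[past ξ k] fun ω => x k ω b)
    (hx2 : ∀ k b, MemLp (fun ω => x k ω b) 2 μ) (hxB : ∀ k b, ∫ ω, x k ω b ^ 2 ∂μ ≤ Bx) :
    ∃ M : ℝ, 0 ≤ M ∧ ∀ {J : Type} [Fintype J] [DecidableEq J] (τ : J → ℕ × κ),
      Function.Injective τ → ∀ (N : ℕ) (ε : ℝ), 0 < ε → 0 < N →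
      μ.real {ω | ¬ (∑ α, ∑ β, (∑ k ∈ Finset.range N, (shiftNoise ξ (τ α) (1 + k) ω *
          shiftNoise ξ (τ β) (1 + k) ω - if α = β then (v (τ α).2 : ℝ) else 0)) ^ 2
            ≤ (ε * N) ^ 2 ∧
        ∑ α, ∑ i, (∑ k ∈ Finset.range N, shiftNoise ξ (τ α) (1 + k) ω * x (1 + k) ω i) ^ 2
            ≤ (ε * N) ^ 2)} ≤ M * (Fintype.card J) ^ 2 / (N * ε ^ 2) := by
  obtain ⟨B, hB, hvB, hqB⟩ := hξ.exists_moment_bound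
  -- Without state coordinates the bound Bx is vacuous and may be negative.
  have hBx : 0 ≤ Bx ∨ n = 0 := by
    rcases Nat.eq_zero_or_pos n with h | h
    · exact Or.inr h
    · exact Or.inl ((integral_nonneg fun _ => sq_nonneg _).trans (hxB 0 ⟨0, h⟩))
  have hnBx : 0 ≤ n * (B * Bx) := by
    rcases hBx with h | h
    · positivity
    · simp [h]
  refine ⟨(B + B * B) + n * (B * Bx), by positivity, ?_⟩
  intro J _ _ τ hτ N ε hε hN
  set P : Ω → ℝ := fun ω => ∑ α, ∑ β, (∑ k ∈ Finset.range N, (shiftNoise ξ (τ α) (1 + k) ω *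
          shiftNoise ξ (τ β) (1 + k) ω - if α = β then (v (τ α).2 : ℝ) else 0)) ^ 2
  set Q : Ω → ℝ := fun ω => ∑ α, ∑ i,
    (∑ k ∈ Finset.range N, shiftNoise ξ (τ α) (1 + k) ω * x (1 + k) ω i) ^ 2
  have hP1 : ∀ α β, Integrable (fun ω => (∑ k ∈ Finset.range N, (shiftNoise ξ (τ α) (1 + k) ω *
          shiftNoise ξ (τ β) (1 + k) ω - if α = β then (v (τ α).2 : ℝ) else 0)) ^ 2) μ ∧
      ∫ ω, (∑ k ∈ Finset.range N, (shiftNoise ξ (τ α) (1 + k) ω *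
          shiftNoise ξ (τ β) (1 + k) ω - if α = β then (v (τ α).2 : ℝ) else 0)) ^ 2 ∂μ
        ≤ N * (B + B * B) := by
    intro α β
    have hN0 : (0 : ℝ) ≤ N := Nat.cast_nonneg N
    by_cases hαβ : α = β
    · subst hαβ
      simp only [if_true]
      have h := hξ.window_diag hB hqB (τ α) N
      refine ⟨h.1, h.2.trans ?_⟩
      exact mul_le_mul_of_nonneg_left (by nlinarith) hN0
    · simp only [hαβ, if_false, sub_zero]
      have h := hξ.window_offdiag hB hvB (fun h => hαβ (hτ h)) (h := τ α) (h' := τ β) N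
      refine ⟨h.1, h.2.trans ?_⟩
      exact mul_le_mul_of_nonneg_left (by nlinarith) hN0
  have hQ1 : ∀ α i, _ := fun α i => hξ.window_state hB hvB (y := fun k ω => x k ω i)
    (fun k => hx k i) (fun k => hx2 k i) (fun k => hxB k i) (τ α) N
  have hPi : Integrable P μ := integrable_finsetSum _ fun α _ =>
    integrable_finsetSum _ fun β _ => (hP1 α β).1
  have hQi : Integrable Q μ := integrable_finsetSum _ fun α _ =>
    integrable_finsetSum _ fun i _ => (hQ1 α i).1
  have hPB : ∫ ω, P ω ∂μ ≤ Fintype.card J ^ 2 * (N * (B + B * B)) := by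
    simp only [P]
    rw [integral_finsetSum _ fun α _ => integrable_finsetSum _ fun β _ => (hP1 α β).1]
    simp_rw [integral_finsetSum _ fun β _ => (hP1 _ β).1]
    calc _ ≤ ∑ α : J, ∑ β : J, (N * (B + B * B) : ℝ) :=
          Finset.sum_le_sum fun α _ => Finset.sum_le_sum fun β _ => (hP1 α β).2
      _ = _ := by simp; ring
  have hQB : ∫ ω, Q ω ∂μ ≤ Fintype.card J ^ 2 * (N * (n * (B * Bx))) := by
    simp only [Q]
    rw [integral_finsetSum _ fun α _ => integrable_finsetSum _ fun β _ => (hQ1 α β).1]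
    simp_rw [integral_finsetSum _ fun β _ => (hQ1 _ β).1]
    calc _ ≤ ∑ α : J, ∑ i : Fin n, (N * (B * Bx) : ℝ) :=
          Finset.sum_le_sum fun α _ => Finset.sum_le_sum fun β _ => (hQ1 α β).2
      _ = Fintype.card J * (N * (n * (B * Bx))) := by
        simp only [Finset.sum_const, Finset.card_univ, Fintype.card_fin, nsmul_eq_mul]
        ring
      _ ≤ _ := by
        refine mul_le_mul_of_nonneg_right ?_ (by positivity)
        have h := Nat.le_self_pow two_ne_zero (Fintype.card J)
        exact_mod_cast h
  have hPQ : ∀ ω, 0 ≤ P ω + Q ω := fun ω => by positivity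
  have hN' : (0 : ℝ) < N := by exact_mod_cast hN
  -- Markov's inequality: at most card² entries of each kind, each of mean square O(N), against the
  -- threshold (εN)².
  have hmk := mul_meas_ge_le_integral_of_nonneg (μ := μ)
    (Filter.Eventually.of_forall hPQ) (hPi.add hQi) ((ε * N) ^ 2)
  have hint : ∫ ω, (P ω + Q ω) ∂μ ≤ Fintype.card J ^ 2 * (N * (B + B * B))
      + Fintype.card J ^ 2 * (N * (n * (B * Bx))) := by
    rw [integral_add hPi hQi]
    exact add_le_add hPB hQB
  have hsub : μ.real {ω | ¬ (P ω ≤ (ε * N) ^ 2 ∧ Q ω ≤ (ε * N) ^ 2)}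
      ≤ μ.real {ω | (ε * N) ^ 2 ≤ P ω + Q ω} := by
    refine measureReal_mono fun ω hω => ?_
    by_contra hcon
    have hP0 : 0 ≤ P ω := by positivity
    have hQ0 : 0 ≤ Q ω := by positivity
    simp only [Set.mem_ofPred_eq, not_le] at hcon
    exact hω ⟨by linarith, by linarith⟩
  refine hsub.trans ?_
  rw [le_div_iff₀ (by positivity)]
  have h1 := hmk.trans hint
  have e : (ε * N) ^ 2 = N * (N * ε ^ 2) := by ring
  rw [e, mul_assoc] at h1
  have h2 : (N : ℝ) * (N * ε ^ 2 * μ.real {ω | N * (N * ε ^ 2) ≤ P ω + Q ω})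
      ≤ N * ((B + B * B + n * (B * Bx)) * Fintype.card J ^ 2) := by
    refine h1.trans (le_of_eq ?_)
    ring
  have h3 := le_of_mul_le_mul_left h2 hN'
  rw [e, mul_comm]
  exact h3

end Concentration

/-! ### Almost sure nondegeneracy along disjoint windows -/

section Minors

variable {Ω : Type*} {mΩ : MeasurableSpace Ω} {μ : Measure Ω} {κ : Type*}
  {ξ : ℕ × κ → Ω → ℝ} {v : κ → NNReal}

/-- Given X and Y, the only bad value of the noise is -Y/X, and a Gaussian of positive variance has
no atoms; Fubini concludes. -/
lemma IsScalarNoise.ae_mul_add_ne_zero [IsProbabilityMeasure μ] (hξ : IsScalarNoise μ ξ v)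
    {h : ℕ × κ} (hv : v h.2 ≠ 0) {X Y : Ω → ℝ} (hX : Measurable[others ξ h] X)
    (hY : Measurable[others ξ h] Y) (hX0 : ∀ᵐ ω ∂μ, X ω ≠ 0) :
    ∀ᵐ ω ∂μ, ξ h ω * X ω + Y ω ≠ 0 := by
  have hXY : Measurable fun ω => (X ω, Y ω) :=
    (hX.mono (hξ.others_le h) le_rfl).prodMk (hY.mono (hξ.others_le h) le_rfl)
  have hind := (hξ.indepFun_others (hX.prodMk hY)).symm
  rw [indepFun_iff_map_prod_eq_prod_map_map hXY.aemeasurable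
    (hξ.measurable h).aemeasurable, hξ.law h] at hind
  have hs : MeasurableSet {z : (ℝ × ℝ) × ℝ | z.1.1 ≠ 0 ∧ z.2 * z.1.1 + z.1.2 = 0} := by
    refine MeasurableSet.inter ?_ ?_
    · exact (measurableSet_eq_fun (measurable_fst.comp measurable_fst) measurable_const).compl
    · exact measurableSet_eq_fun (by fun_prop) measurable_const
  have hnull : (μ.map fun ω => ((X ω, Y ω), ξ h ω))
      {z : (ℝ × ℝ) × ℝ | z.1.1 ≠ 0 ∧ z.2 * z.1.1 + z.1.2 = 0} = 0 := by
    rw [hind, Measure.measure_prod_null hs]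
    refine Filter.Eventually.of_forall fun z => ?_
    have := nullSingletonClass_gaussianReal (μ := 0) hv
    refine measure_mono_null (t := {-z.2 / z.1}) (fun t ht => ?_) (measure_singleton _)
    have h1 : z.1 ≠ 0 := ht.1
    have h2 : t * z.1 + z.2 = 0 := ht.2
    rw [Set.mem_singleton_iff, eq_div_iff h1]
    linarith
  rw [Measure.map_apply (hXY.prodMk (hξ.measurable h)) hs] at hnull
  have h3 : ∀ᵐ ω ∂μ, ¬ (X ω ≠ 0 ∧ ξ h ω * X ω + Y ω = 0) := by
    rw [ae_iff]
    simpa using hnull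
  filter_upwards [hX0, h3] with ω h1 h2 h4
  exact h2 ⟨h1, h4⟩

lemma measurable_matrix_det {m : MeasurableSpace Ω} {n : Type*} [Fintype n] [DecidableEq n]
    {M : Ω → Matrix n n ℝ} (hM : ∀ i j, Measurable fun ω => M ω i j) :
    Measurable fun ω => (M ω).det := by
  simp only [Matrix.det_apply]
  refine Finset.measurable_fun_sum _ fun σ _ => Measurable.const_smul ?_ _
  exact Finset.measurable_fun_prod _ fun i _ => hM _ _

/-- A random matrix is almost surely invertible if each diagonal entry carries a Gaussian
independent of the rest of the leading principal submatrix it completes. -/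
lemma IsScalarNoise.ae_det_ne_zero [IsProbabilityMeasure μ] (hξ : IsScalarNoise μ ξ v)
    (hv : ∀ c, v c ≠ 0) {d : ℕ} {M : Ω → Matrix (Fin d) (Fin d) ℝ} {h : Fin d → ℕ × κ}
    (hdiag : ∀ m, Measurable[others ξ (h m)] fun ω => M ω m m - ξ (h m) ω)
    (hM : ∀ m i j, i ≤ m → j ≤ m → ¬ (i = m ∧ j = m) →
      Measurable[others ξ (h m)] fun ω => M ω i j) :
    ∀ᵐ ω ∂μ, (M ω).det ≠ 0 := by
  induction d with
  | zero => simp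
  | succ d ih =>
    have ih' := ih (M := fun ω => (M ω).submatrix Fin.castSucc Fin.castSucc)
      (h := fun m => h m.castSucc) (fun m => hdiag m.castSucc)
      (fun m i j hi hj hij => hM _ _ _ (by simpa using hi) (by simpa using hj) (by simpa using hij))
    set l := Fin.last d
    have hMl : ∀ i j, ¬ (i = l ∧ j = l) → Measurable[others ξ (h l)] fun ω => M ω i j :=
      fun i j hij => hM l i j (Fin.le_last i) (Fin.le_last j) hij
    have hX : Measurable[others ξ (h l)]
        fun ω => ((M ω).submatrix Fin.castSucc Fin.castSucc).det :=
      measurable_matrix_det fun i j => hMl _ _ fun hij => Fin.castSucc_ne_last _ hij.1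
    -- In the Laplace expansion along the last column, ξ (h l) multiplies only the preceding leading
    -- minor, nonzero by induction; this is the remainder.
    have hY : Measurable[others ξ (h l)] fun ω =>
        (∑ i : Fin d, (-1) ^ ((i.castSucc : ℕ) + (l : ℕ)) * M ω i.castSucc l *
          ((M ω).submatrix i.castSucc.succAbove l.succAbove).det)
        + (M ω l l - ξ (h l) ω) * ((M ω).submatrix Fin.castSucc Fin.castSucc).det := by
      refine Measurable.add (Finset.measurable_fun_sum _ fun i _ => ?_) ((hdiag l).mul hX)
      refine ((hMl _ _ fun hij => Fin.castSucc_ne_last _ hij.1).const_mul _).mul ?_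
      refine measurable_matrix_det fun i' j' => hMl _ _ fun hij => ?_
      rw [Fin.succAbove_last] at hij
      exact Fin.castSucc_ne_last _ hij.2
    filter_upwards [hξ.ae_mul_add_ne_zero (hv _) hX hY ih'] with ω hω hdet
    apply hω
    rw [Matrix.det_succ_column (M ω) l, Fin.sum_univ_castSucc] at hdet
    have e : (-1 : ℝ) ^ ((Fin.last d : ℕ) + (l : ℕ)) = 1 := Even.neg_one_pow ⟨_, rfl⟩
    rw [e, Fin.succAbove_last] at hdet
    rw [Fin.succAbove_last]
    linarith

/-- Continuity of the measure from above along the events q < 1/(n+1). Turns almost sure positivity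
into a bound with a constant. -/
lemma exists_measure_lt_le_of_ae_pos [IsFiniteMeasure μ] {q : Ω → ℝ} (hq : Measurable q)
    (hpos : ∀ᵐ ω ∂μ, 0 < q ω) {ε : ℝ} (hε : 0 < ε) : ∃ c : ℝ, 0 < c ∧ μ.real {ω | q ω < c} ≤ ε := by
  set s : ℕ → Set Ω := fun n => {ω | q ω < 1 / ((n : ℝ) + 1)}
  have hanti : Antitone s := fun m n hmn ω (hω : q ω < _) =>
    lt_of_lt_of_le hω (one_div_le_one_div_of_le (by positivity) (by gcongr))
  have ht := tendsto_measure_iInter_atTop (μ := μ) (s := s)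
    (fun n => (measurableSet_lt hq measurable_const).nullMeasurableSet) hanti
    ⟨0, measure_ne_top μ _⟩
  have hnull : μ (⋂ n, s n) = 0 := by
    refine measure_mono_null (fun ω hω => ?_) (ae_iff.1 hpos)
    intro (hpos' : 0 < q ω)
    obtain ⟨n, hn⟩ := exists_nat_one_div_lt hpos'
    exact lt_asymm hn (Set.mem_iInter.1 hω n)
  rw [hnull] at ht
  have hev := ht.eventually_lt_const (u := ENNReal.ofReal ε) (by simpa using hε)
  obtain ⟨n, hn⟩ := hev.exists
  refine ⟨1 / ((n : ℝ) + 1), by positivity, ?_⟩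
  exact ENNReal.toReal_le_of_le_ofReal hε.le hn.le

/-- Forms `⟨a, g + Γᵀ x⟩` in windows of noises `g` and past states `x` are almost surely jointly
nondegenerate along disjoint windows, with a quantitative version on large events. -/
lemma IsScalarNoise.exists_sum_sq_forms_ge [IsProbabilityMeasure μ] (hξ : IsScalarNoise μ ξ v)
    (hv : ∀ c, v c ≠ 0) {n : ℕ} {x : ℕ → Ω → Fin n → ℝ}
    (hx : ∀ k b, Measurable[past ξ k] fun ω => x k ω b) {J : Type} [Fintype J]
    {τ : J → ℕ × κ} (hτ : Function.Injective τ) {L : ℕ} (hL : ∀ α, (τ α).1 < L)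
    (Γ : Matrix (Fin n) J ℝ) {N : ℕ} (hN : Fintype.card J * L ≤ N) {ε : ℝ} (hε : 0 < ε) :
    ∃ c : ℝ, 0 < c ∧ μ.real {ω | ¬ ∀ a : J → ℝ, c * sqNorm a ≤
      ∑ k ∈ Finset.range N, ((Γ *ᵥ a) ⬝ᵥ x (1 + k) ω
        + ∑ α, a α * shiftNoise ξ (τ α) (1 + k) ω) ^ 2} ≤ ε := by
  classical
  set d := Fintype.card J with hd
  set e : Fin d ≃ J := (Fintype.equivFin J).symm
  -- Row j holds the coefficients of the form in the window starting at 1 + jL. Windows at these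
  -- times do not overlap, and the noise of entry (m, m) occurs nowhere else in rows 0 to m.
  set M : Ω → Matrix (Fin d) (Fin d) ℝ := fun ω => Matrix.of fun j i =>
    shiftNoise ξ (τ (e i)) (1 + j * L) ω + ∑ b, Γ b (e i) * x (1 + j * L) ω b with hMdef
  set h : Fin d → ℕ × κ := fun m => (1 + m * L + (τ (e m)).1, (τ (e m)).2) with hh
  have hsum : ∀ m j i : Fin d, j ≤ m → Measurable[others ξ (h m)]
      fun ω => ∑ b, Γ b (e i) * x (1 + j * L) ω b := by
    intro m j i hjm
    refine Finset.measurable_fun_sum _ fun b _ => Measurable.const_mul ?_ _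
    refine (hx _ b).mono (past_le_others ?_) le_rfl
    have := Nat.mul_le_mul_right L (Fin.le_def.1 hjm)
    simp only [hh]; omega
  have hdet : ∀ᵐ ω ∂μ, (M ω).det ≠ 0 := by
    refine hξ.ae_det_ne_zero hv (h := h) (fun m => ?_) (fun m j i hj hi hij => ?_)
    · have : (fun ω => M ω m m - ξ (h m) ω) = fun ω => ∑ b, Γ b (e m) * x (1 + m * L) ω b := by
        funext ω
        simp [hMdef, shiftNoise, hh]
      rw [this]
      exact hsum m m m le_rfl
    · refine Measurable.add (measurable_others fun he => hij ?_) (hsum m j i hj)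
      have h1 := (Prod.mk.injEq _ _ _ _ ▸ he).1
      have h2 := (Prod.mk.injEq _ _ _ _ ▸ he).2
      -- An earlier window ends before window m begins, because all offsets are below L.
      have hjm : j = m := by
        by_contra hne
        have hlt : (j : ℕ) + 1 ≤ m := lt_of_le_of_ne hj hne
        have := Nat.mul_le_mul_right L hlt
        have := hL (e i)
        rw [add_mul] at *
        omega
      subst hjm
      exact ⟨rfl, e.injective (hτ (Prod.ext (by omega) h2))⟩
  have hMm : ∀ j i, Measurable fun ω => M ω j i := by
    intro j i
    refine Measurable.add (hξ.measurable _) (Finset.measurable_fun_sum _ fun b _ =>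
      Measurable.const_mul ?_ _)
    exact (hx _ b).mono (hξ.past_le _) le_rfl
  have hadj : ∀ j i, Measurable fun ω => (M ω).adjugate j i := by
    intro j i
    simp only [adjugate_apply]
    refine measurable_matrix_det fun i' j' => ?_
    simp only [updateRow_apply]
    split_ifs
    · exact measurable_const
    · exact hMm _ _
  set R : Ω → ℝ := fun ω => ∑ j, ∑ i, (M ω).adjugate j i ^ 2
  have hR : Measurable R := Finset.measurable_fun_sum _ fun j _ =>
    Finset.measurable_fun_sum _ fun i _ => (hadj j i).pow_const 2
  have hR0 : ∀ ω, 0 ≤ R ω := fun ω => by positivity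
  -- The adjugate gives det² |a|² ≤ R |Ma|², so det²/(R+1) bounds |Ma|²/|a|² from below; the 1
  -- avoids dividing by zero.
  obtain ⟨c, hc, hle⟩ := exists_measure_lt_le_of_ae_pos (μ := μ)
    (q := fun ω => (M ω).det ^ 2 / (R ω + 1))
    (((measurable_matrix_det hMm).pow_const 2).div (hR.add_const 1)) (by
      filter_upwards [hdet] with ω hω
      have := hR0 ω
      positivity) hε
  refine ⟨c, hc, le_trans (measureReal_mono fun ω hω => ?_) hle⟩
  by_contra hcon
  refine hω fun a => ?_
  have hc' : c ≤ (M ω).det ^ 2 / (R ω + 1) := not_lt.1 hcon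
  have hRp : 0 < R ω + 1 := by linarith [hR0 ω]
  rw [le_div_iff₀ hRp] at hc'
  have hform : ∀ j : Fin d, (M ω *ᵥ (a ∘ e)) j = (Γ *ᵥ a) ⬝ᵥ x (1 + j * L) ω
      + ∑ α, a α * shiftNoise ξ (τ α) (1 + j * L) ω := by
    intro j
    rw [dotProduct_comm, dotProduct_mulVec]
    simp only [mulVec, vecMul, dotProduct, hMdef, of_apply, Function.comp_apply]
    rw [← e.sum_comp (fun α => (∑ i, x (1 + j * L) ω i * Γ i α) * a α),
      ← e.sum_comp (fun α => a α * shiftNoise ξ (τ α) (1 + j * L) ω), ← Finset.sum_add_distrib]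
    refine Finset.sum_congr rfl fun i _ => ?_
    rw [add_mul, add_comm, mul_comm (a _)]
    congr 2
    exact Finset.sum_congr rfl fun b _ => mul_comm _ _
  have hsq : sqNorm (a ∘ e) = sqNorm a := e.sum_comp fun α => a α ^ 2
  have hlow : (M ω).det ^ 2 * sqNorm a ≤ R ω * sqNorm (M ω *ᵥ (a ∘ e)) := by
    have h1 := sqNorm_mulVec_le_sum_sq (M ω).adjugate (M ω *ᵥ (a ∘ e))
    rw [mulVec_mulVec, adjugate_mul, smul_mulVec, one_mulVec] at h1
    have h2 : sqNorm ((M ω).det • (a ∘ e)) = (M ω).det ^ 2 * sqNorm a := by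
      rw [← hsq]
      simp [sqNorm, Finset.mul_sum, mul_pow]
    rwa [h2] at h1
  have hMa := sqNorm_nonneg (M ω *ᵥ (a ∘ e))
  have h3 : c * sqNorm a ≤ sqNorm (M ω *ᵥ (a ∘ e)) := by
    have h4 : c * (R ω + 1) * sqNorm a ≤ (M ω).det ^ 2 * sqNorm a :=
      mul_le_mul_of_nonneg_right hc' (sqNorm_nonneg a)
    have h5 : (c * sqNorm a) * (R ω + 1) ≤ sqNorm (M ω *ᵥ (a ∘ e)) * (R ω + 1) := by nlinarith
    exact le_of_mul_le_mul_right h5 hRp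
  -- The d selected windows are among the N available ones, and the other squares are nonnegative.
  refine h3.trans ?_
  simp only [sqNorm, hform]
  rcases isEmpty_or_nonempty J with hJ | ⟨⟨α₀⟩⟩
  · have : IsEmpty (Fin d) := by rw [hd, Fintype.card_eq_zero]; infer_instance
    rw [Finset.univ_eq_empty, Finset.sum_empty]
    exact Finset.sum_nonneg fun _ _ => sq_nonneg _
  have hLpos : 0 < L := lt_of_le_of_lt (Nat.zero_le _) (hL α₀)
  have hinj : Function.Injective fun j : Fin d => (j : ℕ) * L := fun i j hij =>
    Fin.ext (Nat.eq_of_mul_eq_mul_right hLpos hij)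
  rw [← Finset.sum_image (f := fun k => ((Γ *ᵥ a) ⬝ᵥ x (1 + k) ω
    + ∑ α, a α * shiftNoise ξ (τ α) (1 + k) ω) ^ 2) (g := fun j : Fin d => (j : ℕ) * L)
    (s := Finset.univ) hinj.injOn]
  refine Finset.sum_le_sum_of_subset_of_nonneg (fun k hk => ?_) fun _ _ _ => sq_nonneg _
  obtain ⟨j, -, rfl⟩ := Finset.mem_image.1 hk
  exact Finset.mem_range.2 (lt_of_lt_of_le (Nat.mul_lt_mul_of_pos_right j.2 hLpos) hN)

end Minors

/-! ### Bounded second moments of states and past data -/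

section StateMoments

variable {Ω : Type*} {mΩ : MeasurableSpace Ω} {μ : Measure Ω}

lemma integrable_sqNorm {n : ℕ} {X : Ω → Fin n → ℝ} (hX : ∀ c, MemLp (fun ω => X ω c) 2 μ) :
    Integrable (fun ω => sqNorm (X ω)) μ :=
  integrable_finsetSum _ fun c _ => (hX c).integrable_sq

lemma measurable_mulVec {m : MeasurableSpace Ω} {a n : ℕ} {X : Ω → Fin a → ℝ}
    (hX : ∀ c, Measurable fun ω => X ω c) (M : Matrix (Fin n) (Fin a) ℝ) (i : Fin n) :
    Measurable fun ω => (M *ᵥ X ω) i :=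
  Finset.measurable_fun_sum Finset.univ (f := fun c ω => M i c * X ω c) fun c _ =>
    (hX c).const_mul (M i c)

lemma memLp_mulVec {a n : ℕ} {X : Ω → Fin a → ℝ} (hX : ∀ c, MemLp (fun ω => X ω c) 2 μ)
    (M : Matrix (Fin n) (Fin a) ℝ) (i : Fin n) : MemLp (fun ω => (M *ᵥ X ω) i) 2 μ :=
  memLp_finsetSum Finset.univ (f := fun c ω => M i c * X ω c) fun c _ => (hX c).const_mul (M i c)

lemma memLp_mulVec_add {a b n : ℕ} {X : Ω → Fin a → ℝ} {Y : Ω → Fin b → ℝ}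
    (hX : ∀ c, MemLp (fun ω => X ω c) 2 μ) (hY : ∀ c, MemLp (fun ω => Y ω c) 2 μ)
    (M : Matrix (Fin n) (Fin a) ℝ) (L : Matrix (Fin n) (Fin b) ℝ) (i : Fin n) :
    MemLp (fun ω => (M *ᵥ X ω + L *ᵥ Y ω) i) 2 μ :=
  (memLp_mulVec hX M i).add (memLp_mulVec hY L i)

lemma integral_sqNorm_mulVec_add_le {a b n : ℕ} {X : Ω → Fin a → ℝ} {Y : Ω → Fin b → ℝ}
    {BX BY : ℝ} (hX : ∀ c, MemLp (fun ω => X ω c) 2 μ) (hY : ∀ c, MemLp (fun ω => Y ω c) 2 μ)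
    (hBX : ∫ ω, sqNorm (X ω) ∂μ ≤ BX) (hBY : ∫ ω, sqNorm (Y ω) ∂μ ≤ BY)
    (M : Matrix (Fin n) (Fin a) ℝ) (L : Matrix (Fin n) (Fin b) ℝ) :
    ∫ ω, sqNorm (M *ᵥ X ω + L *ᵥ Y ω) ∂μ ≤ 2 * ‖M‖ ^ 2 * BX + 2 * ‖L‖ ^ 2 * BY := by
  have i1 := (integrable_sqNorm hX).const_mul (2 * ‖M‖ ^ 2)
  have i2 := (integrable_sqNorm hY).const_mul (2 * ‖L‖ ^ 2)
  calc _ ≤ ∫ ω, (2 * ‖M‖ ^ 2 * sqNorm (X ω) + 2 * ‖L‖ ^ 2 * sqNorm (Y ω)) ∂μ := by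
        refine integral_mono (integrable_sqNorm (memLp_mulVec_add hX hY M L)) (i1.add i2)
          fun ω => ?_
        have h1 := sqNorm_mulVec_le M (X ω)
        have h2 := sqNorm_mulVec_le L (Y ω)
        have h3 := sqNorm_add_le (M *ᵥ X ω) (L *ᵥ Y ω)
        simp only
        linarith
    _ = 2 * ‖M‖ ^ 2 * ∫ ω, sqNorm (X ω) ∂μ + 2 * ‖L‖ ^ 2 * ∫ ω, sqNorm (Y ω) ∂μ := by
        rw [integral_add i1 i2, integral_const_mul, integral_const_mul]
    _ ≤ _ := by gcongr

/-- A stable recursion driven by inputs with bounded second moments has bounded second moments. -/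
lemma exists_integral_sqNorm_le [IsProbabilityMeasure μ] {n : ℕ} {A : Matrix (Fin n) (Fin n) ℝ}
    (hA : specRad A < 1) {x q : ℕ → Ω → Fin n → ℝ} {Bq : ℝ}
    (hq : ∀ k c, MemLp (fun ω => q k ω c) 2 μ) (hBq : ∀ k, ∫ ω, sqNorm (q k ω) ∂μ ≤ Bq)
    (hx0 : ∀ ω, x 0 ω = 0) (hx : ∀ k ω, x (k + 1) ω = A *ᵥ x k ω + q k ω)
    (hx2 : ∀ k c, MemLp (fun ω => x k ω c) 2 μ) :
    ∃ B : ℝ, 0 ≤ B ∧ ∀ k, ∫ ω, sqNorm (x k ω) ∂μ ≤ B := by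
  obtain ⟨m, η, hm, hη0, hη1, hn⟩ := exists_norm_pow_le_of_specRad_lt_one hA
  obtain ⟨V, ρ, C, hρ0, hρ1, hC, hV0, hV1, hV2⟩ := exists_lyapunov hm hη0 hη1 hn
  have hρ : 0 < 1 - ρ := by linarith
  have hBq0 : 0 ≤ Bq := (integral_nonneg fun ω => sqNorm_nonneg _).trans (hBq 0)
  -- Nothing is known about measurability of V, so an integrable majorant of V (x k) is propagated
  -- instead; C Bq/(1-ρ) is the fixed point of the recursion for its mean.
  have key : ∀ k, ∃ r : Ω → ℝ, Integrable r μ ∧ (∀ ω, V (x k ω) ≤ r ω) ∧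
      ∫ ω, r ω ∂μ ≤ C * Bq / (1 - ρ) := by
    intro k
    induction k with
    | zero =>
      refine ⟨fun _ => 0, integrable_zero _ _ _, fun ω => by rw [hx0, hV0], ?_⟩
      simp only [integral_zero]
      positivity
    | succ k ih =>
      obtain ⟨r, hr1, hr2, hr3⟩ := ih
      have i2 := (integrable_sqNorm (hq k)).const_mul C
      refine ⟨fun ω => ρ * r ω + C * sqNorm (q k ω), (hr1.const_mul ρ).add i2, fun ω => ?_, ?_⟩
      · rw [hx]
        exact (hV2 _ _).trans (by linarith [mul_le_mul_of_nonneg_left (hr2 ω) hρ0])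
      · rw [integral_add (hr1.const_mul ρ) i2, integral_const_mul, integral_const_mul]
        have h1 := mul_le_mul_of_nonneg_left hr3 hρ0
        have h2 := mul_le_mul_of_nonneg_left (hBq k) hC
        have h3 : ρ * (C * Bq / (1 - ρ)) + C * Bq = C * Bq / (1 - ρ) := by
          field_simp; ring
        linarith
  refine ⟨C * Bq / (1 - ρ), by positivity, fun k => ?_⟩
  obtain ⟨r, hr1, hr2, hr3⟩ := key k
  exact (integral_mono (integrable_sqNorm (hx2 k)) hr1 fun ω => (hV1 _).trans (hr2 ω)).trans hr3

namespace LinSys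

variable {nx nu ny : ℕ} (S : LinSys nx nu ny) (u : RandSeq Ω nu) (e : RandSeq Ω ny)

lemma measurable_state_past (k : ℕ) (b : Fin nx) :
    Measurable[past (noise u e) k] fun ω => S.state u e k ω b := by
  induction k generalizing b with
  | zero => exact measurable_const
  | succ k ih =>
    rcases Nat.eq_zero_or_pos k with rfl | hk
    · exact measurable_const
    · simp only [S.state_succ u e hk]
      have hle : past (noise u e) k ≤ past (noise u e) (k + 1) := past_mono (Nat.le_succ k)
      exact Measurable.add (measurable_mulVec (fun c => (ih c).mono hle le_rfl) S.A b)
        (Measurable.add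
          (measurable_mulVec (fun c => measurable_past (ξ := noise u e) (j := (k, Sum.inl c))
            (Nat.lt_succ_self k)) S.B b)
          (measurable_mulVec (fun c => measurable_past (ξ := noise u e) (j := (k, Sum.inr c))
            (Nat.lt_succ_self k)) (S.K * S.SeSqrt) b))

variable {S u e} {v : Fin nu ⊕ Fin ny → NNReal}

lemma memLp_input (hξ : IsScalarNoise μ (noise u e) v) (k : ℕ) (c : Fin nu) :
    MemLp (fun ω => u k ω c) 2 μ :=
  hξ.memLp_two (k, Sum.inl c)

lemma memLp_innovation (hξ : IsScalarNoise μ (noise u e) v) (k : ℕ) (c : Fin ny) :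
    MemLp (fun ω => e k ω c) 2 μ :=
  hξ.memLp_two (k, Sum.inr c)

lemma integral_sqNorm_input (hξ : IsScalarNoise μ (noise u e) v) (k : ℕ) :
    ∫ ω, sqNorm (u k ω) ∂μ = ∑ c, (v (Sum.inl c) : ℝ) := by
  simp only [sqNorm]
  rw [integral_finsetSum _ fun c _ => (memLp_input hξ k c).integrable_sq]
  exact Finset.sum_congr rfl fun c _ => hξ.integral_sq (k, Sum.inl c)

lemma integral_sqNorm_innovation (hξ : IsScalarNoise μ (noise u e) v) (k : ℕ) :
    ∫ ω, sqNorm (e k ω) ∂μ = ∑ c, (v (Sum.inr c) : ℝ) := by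
  simp only [sqNorm]
  rw [integral_finsetSum _ fun c _ => (memLp_innovation hξ k c).integrable_sq]
  exact Finset.sum_congr rfl fun c _ => hξ.integral_sq (k, Sum.inr c)

lemma memLp_state [IsProbabilityMeasure μ] (hξ : IsScalarNoise μ (noise u e) v) (k : ℕ)
    (b : Fin nx) : MemLp (fun ω => S.state u e k ω b) 2 μ := by
  induction k generalizing b with
  | zero => exact memLp_const 0
  | succ k ih =>
    rcases Nat.eq_zero_or_pos k with rfl | hk
    · exact memLp_const 0
    · simp only [S.state_succ u e hk]
      exact (memLp_mulVec ih S.A b).add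
        (memLp_mulVec_add (memLp_input hξ k) (memLp_innovation hξ k) _ _ b)

lemma exists_integral_sqNorm_state_le [IsProbabilityMeasure μ] (hA : specRad S.A < 1)
    (hξ : IsScalarNoise μ (noise u e) v) :
    ∃ B : ℝ, 0 ≤ B ∧ ∀ k, ∫ ω, sqNorm (S.state u e k ω) ∂μ ≤ B := by
  -- The forcing is switched off at index 0, since the system starts at time 1 with x 1 = 0.
  set q : ℕ → Ω → Fin nx → ℝ := fun k ω =>
    if k = 0 then 0 else S.B *ᵥ u k ω + (S.K * S.SeSqrt) *ᵥ e k ω with hqdef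
  have hv : ∀ w : Fin nu ⊕ Fin ny, (0 : ℝ) ≤ v w := fun w => (v w).2
  refine exists_integral_sqNorm_le hA (q := q) (Bq := 2 * ‖S.B‖ ^ 2 * ∑ c, (v (Sum.inl c) : ℝ)
    + 2 * ‖S.K * S.SeSqrt‖ ^ 2 * ∑ c, (v (Sum.inr c) : ℝ)) (fun k c => ?_) (fun k => ?_)
    (fun _ => rfl) (fun k ω => ?_) (memLp_state hξ)
  · by_cases hk : k = 0
    · simp only [hqdef, hk, if_true]; exact memLp_const 0
    · simp only [hqdef, hk, if_false]
      exact memLp_mulVec_add (memLp_input hξ k) (memLp_innovation hξ k) _ _ c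
  · by_cases hk : k = 0
    · simp only [hqdef, hk, if_true, sqNorm_zero, integral_zero]
      positivity
    · simp only [hqdef, hk, if_false]
      exact integral_sqNorm_mulVec_add_le (memLp_input hξ k) (memLp_innovation hξ k)
        (integral_sqNorm_input hξ k).le (integral_sqNorm_innovation hξ k).le _ _
  · rcases Nat.eq_zero_or_pos k with rfl | hk
    · simp [hqdef, state]
    · rw [S.state_succ u e hk]
      simp [hqdef, hk.ne']

lemma integral_sq_state_le [IsProbabilityMeasure μ] (hξ : IsScalarNoise μ (noise u e) v) {B : ℝ}
    (hB : ∀ k, ∫ ω, sqNorm (S.state u e k ω) ∂μ ≤ B) (k : ℕ) (b : Fin nx) :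
    ∫ ω, S.state u e k ω b ^ 2 ∂μ ≤ B :=
  (integral_mono (memLp_state hξ k b).integrable_sq (integrable_sqNorm (memLp_state hξ k))
    fun ω => Finset.single_le_sum (f := fun b => S.state u e k ω b ^ 2)
      (fun _ _ => sq_nonneg _) (Finset.mem_univ b)).trans (hB k)

lemma sum_sq_Zp {p N : ℕ} (ω : Ω) :
    ∑ j, ∑ i, Zp S u e p N ω i j ^ 2 = ∑ j : Fin N, ∑ r : Fin p,
      (sqNorm (S.output u e (1 + j + r) ω) + sqNorm (u (1 + j + r) ω)) := by
  refine Finset.sum_congr rfl fun j _ => ?_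
  rw [Fintype.sum_sum_type, Fintype.sum_prod_type, Fintype.sum_prod_type, Finset.sum_add_distrib]
  rfl

/-- Past data are of size `√(N p)` in mean square. -/
lemma exists_measure_sum_sq_Zp_le [IsProbabilityMeasure μ] (hA : specRad S.A < 1)
    (hξ : IsScalarNoise μ (noise u e) v) :
    ∃ B : ℝ, 0 < B ∧ ∀ (p N : ℕ) (ε : ℝ), 0 < ε → 0 < p → 0 < N →
      μ.real {ω | ¬ ∑ j, ∑ i, Zp S u e p N ω i j ^ 2 ≤ N * (B * p / ε)} ≤ ε := by
  obtain ⟨B, hB0, hB⟩ := exists_integral_sqNorm_state_le hA hξ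
  have hv : ∀ w : Fin nu ⊕ Fin ny, (0 : ℝ) ≤ v w := fun w => (v w).2
  set By := 2 * ‖S.C‖ ^ 2 * B + 2 * ‖S.SeSqrt‖ ^ 2 * ∑ c, (v (Sum.inr c) : ℝ)
  set Bu := ∑ c, (v (Sum.inl c) : ℝ)
  have hy : ∀ k, Integrable (fun ω => sqNorm (S.output u e k ω)) μ := fun k =>
    integrable_sqNorm (memLp_mulVec_add (memLp_state hξ k) (memLp_innovation hξ k) _ _)
  have hyB : ∀ k, ∫ ω, sqNorm (S.output u e k ω) ∂μ ≤ By := fun k =>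
    integral_sqNorm_mulVec_add_le (memLp_state hξ k) (memLp_innovation hξ k) (hB k)
      (integral_sqNorm_innovation hξ k).le _ _
  have hu : ∀ k, Integrable (fun ω => sqNorm (u k ω)) μ := fun k =>
    integrable_sqNorm (memLp_input hξ k)
  -- Markov's inequality for the sum of Np column blocks; the 1 makes the constant positive.
  refine ⟨By + Bu + 1, by positivity, fun p N ε hε hp hN => ?_⟩
  have hp' : (0 : ℝ) < p := by exact_mod_cast hp
  have hN' : (0 : ℝ) < N := by exact_mod_cast hN
  simp_rw [sum_sq_Zp]
  have hyu : ∀ k, Integrable (fun ω => sqNorm (S.output u e k ω) + sqNorm (u k ω)) μ := fun k =>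
    (hy k).add (hu k)
  have hi : Integrable (fun ω => ∑ j : Fin N, ∑ r : Fin p,
      (sqNorm (S.output u e (1 + j + r) ω) + sqNorm (u (1 + j + r) ω))) μ :=
    integrable_finsetSum _ fun j _ => integrable_finsetSum _ fun r _ => hyu _
  have hint : ∫ ω, ∑ j : Fin N, ∑ r : Fin p,
      (sqNorm (S.output u e (1 + j + r) ω) + sqNorm (u (1 + j + r) ω)) ∂μ
      ≤ N * (p * (By + Bu + 1)) := by
    rw [integral_finsetSum _ fun j _ => integrable_finsetSum _ fun r _ => hyu _]
    simp_rw [integral_finsetSum _ fun (r : Fin p) _ => hyu _,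
      integral_add (hy _) (hu _)]
    calc _ ≤ ∑ j : Fin N, ∑ r : Fin p, (By + Bu + 1) :=
          Finset.sum_le_sum fun j _ => Finset.sum_le_sum fun r _ => by
            linarith [hyB (1 + j + r), (integral_sqNorm_input hξ (1 + j + r)).le]
      _ = _ := by simp only [Finset.sum_const, Finset.card_univ, Fintype.card_fin, nsmul_eq_mul]
  have hmk := (mul_meas_ge_le_integral_of_nonneg (μ := μ) (Filter.Eventually.of_forall fun ω =>
    Finset.sum_nonneg fun j _ => Finset.sum_nonneg fun r _ =>
      add_nonneg (sqNorm_nonneg _) (sqNorm_nonneg _)) hi (N * ((By + Bu + 1) * p / ε))).trans hint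
  have hBpos : 0 < By + Bu + 1 := by positivity
  refine le_trans (measureReal_mono fun ω hω => (not_le.1 hω).le) ?_
  have h1 : (N : ℝ) * (p * (By + Bu + 1)) = N * ((By + Bu + 1) * p / ε) * ε := by
    field_simp
  rw [h1] at hmk
  exact le_of_mul_le_mul_left hmk (by positivity)

end LinSys

end StateMoments

/-! ### The burn-in time dominates the squared dimension -/

section BurnInBounds

lemma one_le_log_of_three_le {x : ℝ} (hx : 3 ≤ x) : 1 ≤ Real.log x := by
  rw [Real.le_log_iff_exp_le (by linarith)]
  exact (Real.exp_one_lt_d9.le.trans (by norm_num)).trans hx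

lemma noiseBound_nonneg (n N : ℕ) (δ : ℝ) : 0 ≤ noiseBound n N δ :=
  mul_nonneg (Nat.cast_nonneg n) (Real.sqrt_nonneg _)

lemma le_noiseBound_sq {n N : ℕ} {δ : ℝ} (hn : 0 < n) (hN : 0 < N) (hδ0 : 0 < δ) (hδ1 : δ < 1) :
    (n : ℝ) ≤ noiseBound n N δ ^ 2 := by
  have hn' : (1 : ℝ) ≤ n := by exact_mod_cast hn
  have hN' : (1 : ℝ) ≤ N := by exact_mod_cast hN
  have hlog : 1 ≤ Real.log (32 * n * N / δ) := by
    refine one_le_log_of_three_le ?_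
    rw [le_div_iff₀ hδ0]
    nlinarith [mul_le_mul hn' hN' zero_le_one (by linarith)]
  rw [noiseBound, mul_pow, Real.sq_sqrt (by positivity)]
  have h1 : (1 : ℝ) ≤ n ^ 2 := one_le_pow₀ hn'
  have h2 : (n : ℝ) ≤ 2 * n * Real.log (32 * n * N / δ) := by nlinarith
  nlinarith

variable {nu ny p i : ℕ} {δ : ℝ}

lemma add_le_dimP (hnu : 0 < nu) (hny : 0 < ny) : 2 * p + i ≤ dimP nu ny p i := by
  have h1 : p * 2 ≤ p * (nu + ny) := Nat.mul_le_mul_left p (by omega)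
  have h2 : i * 1 ≤ i * nu := Nat.mul_le_mul_left i hnu
  simp only [dimP]
  omega

/-- Each squared noise bound is at least its dimension, so w̄² ≥ ny p + nu (p + i) = d. Since d ≥ 3
makes log(d/δ) ≥ 1, the threshold 32 w̄⁴ log(d/δ) is at least d². -/
lemma sq_dimP_le_NW (hnu : 0 < nu) (hny : 0 < ny) (hp : 0 < p) (hi : 0 < i) (hδ0 : 0 < δ)
    (hδ1 : δ < 1) {N : ℕ} (hN : 0 < N) : (dimP nu ny p i : ℝ) ^ 2 ≤ NW nu ny p i N δ := by
  have hd : (3 : ℝ) ≤ dimP nu ny p i := by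
    have := add_le_dimP (p := p) (i := i) hnu hny
    exact_mod_cast (show 3 ≤ dimP nu ny p i by omega)
  have hlog : 1 ≤ Real.log (dimP nu ny p i / δ) := by
    refine one_le_log_of_three_le ?_
    rw [le_div_iff₀ hδ0]
    nlinarith
  have hw : (dimP nu ny p i : ℝ) ≤ wBar nu ny p i N δ ^ 2 := by
    have h1 := le_noiseBound_sq hny hN hδ0 hδ1
    have h2 := le_noiseBound_sq hnu hN hδ0 hδ1
    have h3 := noiseBound_nonneg ny N δ
    have h4 := noiseBound_nonneg nu N δ
    have e : wBar nu ny p i N δ ^ 2 = noiseBound ny N δ ^ 2 * p + noiseBound nu N δ ^ 2 * (p + i)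
        + 2 * (noiseBound ny N δ * √p * (noiseBound nu N δ * √(p + i))) := by
      have s1 : √(p : ℝ) ^ 2 = p := Real.sq_sqrt (by positivity)
      have s2 : √((p : ℝ) + i) ^ 2 = p + i := Real.sq_sqrt (by positivity)
      rw [wBar, add_sq, mul_pow, mul_pow, s1, s2]
      ring
    have h5 : 0 ≤ noiseBound ny N δ * √p * (noiseBound nu N δ * √(p + i)) := by positivity
    have h6 := mul_le_mul_of_nonneg_right h1 (Nat.cast_nonneg (α := ℝ) p)
    have h7 := mul_le_mul_of_nonneg_right h2 (by positivity : (0 : ℝ) ≤ p + i)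
    rw [e]
    simp only [dimP]
    push_cast
    linarith
  have hr : rBar nu ny p i N δ ^ 2
      = 8 * (wBar nu ny p i N δ ^ 2) ^ 2 * Real.log (dimP nu ny p i / δ) := by
    rw [rBar, mul_pow, Real.sq_sqrt (by positivity)]
    ring
  rw [NW, hr]
  have h1 : (dimP nu ny p i : ℝ) ^ 2 ≤ (wBar nu ny p i N δ ^ 2) ^ 2 :=
    pow_le_pow_left₀ (by positivity) hw 2
  nlinarith [mul_le_mul h1 hlog zero_le_one (by positivity), sq_nonneg (dimP nu ny p i : ℝ)]

/-- At N = t⁴ the logarithm is at most linear in t, so the noise bound grows like √t. As the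
threshold is quartic in the noise bounds, it is then O(t²), far below t⁴. -/
lemma noiseBound_pow_four_le {n t : ℕ} (hn : 0 < n) (ht : 0 < t) (hδ0 : 0 < δ) (hδ1 : δ < 1) :
    noiseBound n (t ^ 4) δ ≤ n * √(2 * n * (Real.log (32 * n / δ) + 4)) * √t := by
  have hn' : (1 : ℝ) ≤ n := by exact_mod_cast hn
  have ht' : (1 : ℝ) ≤ t := by exact_mod_cast ht
  have hlog : 1 ≤ Real.log (32 * n / δ) := by
    refine one_le_log_of_three_le ?_
    rw [le_div_iff₀ hδ0]
    nlinarith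
  rw [noiseBound, mul_assoc (n : ℝ) _ √(t : ℝ), ← Real.sqrt_mul (by positivity)]
  refine mul_le_mul_of_nonneg_left (Real.sqrt_le_sqrt ?_) (by positivity)
  rw [mul_assoc (2 * (n : ℝ))]
  refine mul_le_mul_of_nonneg_left ?_ (by positivity)
  have e : 32 * (n : ℝ) * ((t ^ 4 : ℕ) : ℝ) / δ = 32 * n / δ * t ^ 4 := by push_cast; ring
  rw [e, Real.log_mul (by positivity) (by positivity), Real.log_pow]
  have h1 := Real.log_le_sub_one_of_pos (by linarith : (0 : ℝ) < t)
  push_cast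
  nlinarith

/-- Shows that the set defining `burnIn` is nonempty, whatever value K the other threshold takes;
otherwise its infimum would be the default 0 and carry no information. -/
lemma exists_NW_le (hnu : 0 < nu) (hny : 0 < ny) (hδ0 : 0 < δ) (hδ1 : δ < 1) (K : ℕ) :
    ∃ N : ℕ, 1 ≤ N ∧ NW nu ny p i N δ ≤ N ∧ K ≤ N := by
  set W : ℝ := ny * √(2 * ny * (Real.log (32 * ny / δ) + 4)) * √p
    + nu * √(2 * nu * (Real.log (32 * nu / δ) + 4)) * √(p + i) with hW
  set s : ℝ := √(2 * Real.log (dimP nu ny p i / δ))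
  obtain ⟨t, ht⟩ := exists_nat_ge (16 * W ^ 4 * s ^ 2 + K + 1)
  have hW0 : 0 ≤ W := by positivity
  have hc : 0 ≤ 16 * W ^ 4 * s ^ 2 := by positivity
  have hK : (0 : ℝ) ≤ K := Nat.cast_nonneg K
  have ht1 : (1 : ℝ) ≤ t := by linarith
  have ht0 : 0 < t := by exact_mod_cast (by linarith : (0 : ℝ) < t)
  refine ⟨t ^ 4, Nat.one_le_pow _ _ ht0, ?_, ?_⟩
  · have hw : wBar nu ny p i (t ^ 4) δ ≤ W * √t := by
      have h1 := mul_le_mul_of_nonneg_right (noiseBound_pow_four_le hny ht0 hδ0 hδ1)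
        (Real.sqrt_nonneg (p : ℝ))
      have h2 := mul_le_mul_of_nonneg_right (noiseBound_pow_four_le hnu ht0 hδ0 hδ1)
        (Real.sqrt_nonneg ((p : ℝ) + i))
      rw [wBar, hW]
      linarith
    have hw0 : 0 ≤ wBar nu ny p i (t ^ 4) δ :=
      add_nonneg (mul_nonneg (noiseBound_nonneg _ _ _) (Real.sqrt_nonneg _))
        (mul_nonneg (noiseBound_nonneg _ _ _) (Real.sqrt_nonneg _))
    have hw4 : wBar nu ny p i (t ^ 4) δ ^ 4 ≤ W ^ 4 * t ^ 2 := by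
      have h1 := pow_le_pow_left₀ hw0 hw 4
      have h2 : (W * √t) ^ 4 = W ^ 4 * (√t ^ 2) ^ 2 := by ring
      rwa [h2, Real.sq_sqrt (Nat.cast_nonneg t)] at h1
    have e : NW nu ny p i (t ^ 4) δ = 16 * wBar nu ny p i (t ^ 4) δ ^ 4 * s ^ 2 := by
      rw [NW, rBar]; ring
    rw [e]
    push_cast
    have h1 : 16 * wBar nu ny p i (t ^ 4) δ ^ 4 * s ^ 2 ≤ 16 * (W ^ 4 * t ^ 2) * s ^ 2 := by
      gcongr
    have h2 : 16 * W ^ 4 * s ^ 2 ≤ (t : ℝ) ^ 2 := by nlinarith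
    have h3 : 0 ≤ (t : ℝ) ^ 2 := sq_nonneg _
    nlinarith [mul_le_mul_of_nonneg_right h2 h3]
  · have h1 : K ≤ t := by exact_mod_cast (by linarith : (K : ℝ) ≤ t)
    exact h1.trans (Nat.le_self_pow (by norm_num) t)

/-- The burn-in time exceeds the squared problem dimension. -/
lemma sq_dimP_le_of_burnIn_le {nx : ℕ} {S : LinSys nx nu ny} {Ω : Type*} [MeasurableSpace Ω]
    {μ : Measure Ω} {u : RandSeq Ω nu} {e : RandSeq Ω ny} {σ : ℝ} (hnu : 0 < nu) (hny : 0 < ny)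
    (hp : 0 < p) (hi : 0 < i) (hδ0 : 0 < δ) (hδ1 : δ < 1) {N : ℕ}
    (h : burnIn S μ u e σ δ p i ≤ N) : dimP nu ny p i ^ 2 ≤ N := by
  have hmem : burnIn S μ u e σ δ p i ∈
      {N : ℕ | 1 ≤ N ∧ NW nu ny p i N δ ≤ N ∧ NPhi S μ u e σ δ p i ≤ N} :=
    Nat.sInf_mem (exists_NW_le hnu hny hδ0 hδ1 _)
  have h1 := (sq_dimP_le_NW hnu hny hp hi hδ0 hδ1 hmem.1).trans hmem.2.1
  exact le_trans (by exact_mod_cast h1) h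

end BurnInBounds

/-! ### Uniform excitation of the data -/

section DataBounds

variable {Ω : Type*} {mΩ : MeasurableSpace Ω} {μ : Measure Ω} [IsProbabilityMeasure μ]
  {nx nu ny : ℕ} {S : LinSys nx nu ny} {u : RandSeq Ω nu} {e : RandSeq Ω ny}
  {v : Fin nu ⊕ Fin ny → NNReal}

/-- The event that all weighted combinations of the data rows are bounded below. -/
def dataExcited (S : LinSys nx nu ny) (u : RandSeq Ω nu) (e : RandSeq Ω ny) (p f N : ℕ) (c : ℝ) :
    Set Ω :=
  {ω | ∀ (y : (Fin p × Fin ny) ⊕ (Fin p × Fin nu) → ℝ) (s : Fin f × Fin nu → ℝ),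
    c * N * (sqNorm y + sqNorm s) ≤ sqNorm ((Zp S u e p N ω)ᵀ *ᵥ y + (Uf u p f N ω)ᵀ *ᵥ s)}

lemma dataExcited_anti {p f N : ℕ} {c c' : ℝ} (h : c ≤ c') :
    dataExcited S u e p f N c' ⊆ dataExcited S u e p f N c := by
  intro ω hω y s
  refine le_trans ?_ (hω y s)
  have := sqNorm_nonneg y
  have := sqNorm_nonneg s
  gcongr

lemma sqNorm_weighted_eq (hSe : S.Se.PosDef) {p f N : ℕ}
    (y : (Fin p × Fin ny) ⊕ (Fin p × Fin nu) → ℝ) (s : Fin f × Fin nu → ℝ) (ω : Ω) :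
    sqNorm ((Zp S u e p N ω)ᵀ *ᵥ y + (Uf u p f N ω)ᵀ *ᵥ s)
      = ∑ k ∈ Finset.range N,
        ((S.initialWeights S.SeSqrt p f *ᵥ S.windowWeights S.SeSqrt y s)
            ⬝ᵥ S.state u e (1 + k) ω
          + ∑ α, S.windowWeights S.SeSqrt y s α
            * shiftNoise (noise u e) (winPos α) (1 + k) ω) ^ 2 := by
  rw [Finset.sum_range]
  exact Finset.sum_congr rfl fun j _ => by rw [S.weighted_column_eq u e hSe y s ω j]; rfl

lemma card_winIdx (nu ny p f : ℕ) : Fintype.card (WinIdx nu ny p f) = dimP nu ny p f := by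
  simp [WinIdx, dimP]
  ring

/-- Moment concentration with constants free of p, f and N; useful once N is large compared with d².
-/
lemma exists_dataExcited_large (hSe : S.Se.PosDef) (hA : specRad S.A < 1)
    (hAK : specRad S.AK < 1) (hξ : IsScalarNoise μ (noise u e) v) {v₀ : ℝ} (hv₀ : 0 < v₀)
    (hv : ∀ c, v₀ ≤ v c) : ∃ c M : ℝ, 0 < c ∧ 0 ≤ M ∧ ∀ p f N : ℕ, 0 < N →
      μ.real (dataExcited S u e p f N c)ᶜ ≤ M * (dimP nu ny p f : ℝ) ^ 2 / N := by
  obtain ⟨c₁, hc₁, hbd⟩ := S.exists_windowWeights_bound hAK (S.isUnit_seSqrt_det hSe)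
  obtain ⟨Bx, hBx0, hBx⟩ := LinSys.exists_integral_sqNorm_state_le hA hξ
  obtain ⟨M, hM, hwin⟩ := hξ.measure_window_le (S.measurable_state_past u e)
    (LinSys.memLp_state hξ) (LinSys.integral_sq_state_le hξ hBx)
  -- Chosen so that the deviations, including the cross term with |b| ≤ √c₁ |a|, cost exactly half
  -- of v₀.
  set ε := v₀ / (2 * (1 + 2 * √c₁)) with hεdef
  have hε : 0 < ε := by positivity
  refine ⟨v₀ / (2 * c₁), M / ε ^ 2, by positivity, by positivity, fun p f N hN => ?_⟩
  have hN' : (0 : ℝ) < N := by exact_mod_cast hN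
  have h := hwin (J := WinIdx nu ny p f) winPos winPos_injective N ε hε hN
  rw [card_winIdx] at h
  have e1 : M * (dimP nu ny p f : ℝ) ^ 2 / (N * ε ^ 2)
      = M / ε ^ 2 * (dimP nu ny p f : ℝ) ^ 2 / N := by field_simp
  rw [e1] at h
  refine le_trans (measureReal_mono fun ω hω => ?_) h
  refine by_contra fun hcon => hω fun y s => ?_
  have hω' := not_not.1 hcon
  rw [sqNorm_weighted_eq hSe]
  set a := S.windowWeights S.SeSqrt y s
  set b := S.initialWeights S.SeSqrt p f *ᵥ a
  obtain ⟨hb1, hb2⟩ := hbd p f y s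
  have hge := sum_sq_forms_ge (v := fun α : WinIdx nu ny p f => (v (winPos α).2 : ℝ))
    (by positivity : 0 ≤ ε * N) (fun α => hv _) hω'.1 hω'.2 a b
  refine le_trans ?_ hge
  have ha := sqNorm_nonneg a
  have hs : √(sqNorm a * sqNorm b) ≤ √c₁ * sqNorm a := by
    calc _ ≤ √(c₁ * sqNorm a ^ 2) := Real.sqrt_le_sqrt (by
          rw [sq, ← mul_assoc, mul_comm c₁, mul_assoc]
          exact mul_le_mul_of_nonneg_left hb2 ha)
      _ = _ := by rw [Real.sqrt_mul hc₁.le, Real.sqrt_sq ha]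
  have hε2 : ε * (1 + 2 * √c₁) = v₀ / 2 := by
    rw [hεdef]; field_simp
  have h1 : v₀ / (2 * c₁) * N * (sqNorm y + sqNorm s) ≤ v₀ / (2 * c₁) * N * (c₁ * sqNorm a) :=
    mul_le_mul_of_nonneg_left hb1 (by positivity)
  have h2 : v₀ / (2 * c₁) * N * (c₁ * sqNorm a) = N * (v₀ / 2) * sqNorm a := by field_simp
  have h3 := mul_le_mul_of_nonneg_left hs (by positivity : 0 ≤ 2 * (ε * N))
  have h4 : (N * v₀ - ε * N) * sqNorm a - 2 * (ε * N) * (√c₁ * sqNorm a)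
      = N * (v₀ - ε * (1 + 2 * √c₁)) * sqNorm a := by ring
  rw [hε2] at h4
  linarith

/-- Covers a single pair (p, N), with no control on how c depends on it. There are d window forms
and each window has length p + f, hence the requirement d(p + f) ≤ N. -/
lemma exists_dataExcited (hSe : S.Se.PosDef) (hAK : specRad S.AK < 1)
    (hξ : IsScalarNoise μ (noise u e) v) (hv : ∀ c, v c ≠ 0) {p f N : ℕ} (hN0 : 0 < N)
    (hN : dimP nu ny p f * (p + f) ≤ N) {ε : ℝ} (hε : 0 < ε) :
    ∃ c : ℝ, 0 < c ∧ μ.real (dataExcited S u e p f N c)ᶜ ≤ ε := by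
  obtain ⟨c₁, hc₁, hbd⟩ := S.exists_windowWeights_bound hAK (S.isUnit_seSqrt_det hSe)
  rw [← card_winIdx] at hN
  obtain ⟨c, hc, h⟩ := hξ.exists_sum_sq_forms_ge hv (S.measurable_state_past u e)
    (winPos_injective (nu := nu) (ny := ny) (p := p) (f := f)) winPos_fst_lt
    (S.initialWeights S.SeSqrt p f) hN hε
  have hN' : (0 : ℝ) < N := by exact_mod_cast hN0
  refine ⟨c / (c₁ * N), by positivity, le_trans (measureReal_mono fun ω hω => ?_) h⟩
  refine by_contra fun hcon => hω fun y s => ?_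
  have hω' := not_not.1 hcon
  rw [sqNorm_weighted_eq hSe]
  refine le_trans ?_ (hω' (S.windowWeights S.SeSqrt y s))
  have e1 : c / (c₁ * N) * N * (sqNorm y + sqNorm s) = c * ((sqNorm y + sqNorm s) / c₁) := by
    field_simp
  rw [e1]
  refine mul_le_mul_of_nonneg_left ?_ hc.le
  rw [div_le_iff₀ hc₁, mul_comm]
  exact (hbd p f y s).1

lemma exists_pos_forall_le {α : Type*} (s : Finset α) {g : α → ℝ} (hg : ∀ x, 0 < g x) :
    ∃ c : ℝ, 0 < c ∧ ∀ x ∈ s, c ≤ g x := by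
  classical
  induction s using Finset.induction_on with
  | empty => exact ⟨1, one_pos, by simp⟩
  | insert a s _ ih =>
    obtain ⟨c, hc, h⟩ := ih
    refine ⟨min c (g a), lt_min hc (hg a), fun x hx => ?_⟩
    rcases Finset.mem_insert.1 hx with rfl | hx
    · exact min_le_right _ _
    · exact (min_le_left _ _).trans (h x hx)

lemma exists_forall_mul_sq_log_le (C : ℝ) {ε : ℝ} (hε : 0 < ε) :
    ∃ N₀ : ℕ, ∀ N : ℕ, N₀ ≤ N → C * (1 + Real.log N) ^ 2 / N ≤ ε := by
  have h1 : Filter.Tendsto (fun x : ℝ => C * (1 + Real.log x) ^ 2 / x) Filter.atTop (nhds 0) := by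
    have l0 : Filter.Tendsto (fun x : ℝ => 1 / x) Filter.atTop (nhds 0) := by
      simpa using tendsto_inv_atTop_zero (𝕜 := ℝ)
    have l1 : Filter.Tendsto (fun x : ℝ => Real.log x ^ 1 / x) Filter.atTop (nhds 0) := by
      simpa using Real.tendsto_pow_log_div_mul_add_atTop 1 0 1 one_ne_zero
    have l2 : Filter.Tendsto (fun x : ℝ => Real.log x ^ 2 / x) Filter.atTop (nhds 0) := by
      simpa using Real.tendsto_pow_log_div_mul_add_atTop 1 0 2 one_ne_zero
    have := (((l1.const_mul 2).add l2).add l0).const_mul C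
    simp only [mul_zero, add_zero] at this
    refine this.congr fun x => ?_
    ring
  have h2 := (h1.comp tendsto_natCast_atTop_atTop).eventually_le_const hε
  exact Filter.eventually_atTop.1 h2

/-- Uniform excitation of the data for all admissible horizons and sample sizes. -/
lemma exists_dataExcited_uniform (hnu : 0 < nu) (hny : 0 < ny) (hSe : S.Se.PosDef)
    (hA : specRad S.A < 1) (hAK : specRad S.AK < 1) (hξ : IsScalarNoise μ (noise u e) v)
    (hv : ∀ c, v c ≠ 0) (f : ℕ) (β : ℝ) {ε : ℝ} (hε : 0 < ε) :
    ∃ c : ℝ, 0 < c ∧ ∀ p N : ℕ, 0 < p → (p : ℝ) ≤ β * (1 + Real.log N) →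
      dimP nu ny p f ^ 2 ≤ N → μ.real (dataExcited S u e p f N c)ᶜ ≤ ε := by
  obtain ⟨v₀, hv₀, hv₀le⟩ := exists_pos_forall_le Finset.univ (g := fun c => (v c : ℝ))
    fun c => NNReal.coe_pos.2 (pos_iff_ne_zero.2 (hv c))
  obtain ⟨c₁, M, hc₁, hM, hlarge⟩ := exists_dataExcited_large hSe hA hAK hξ hv₀
    fun c => hv₀le c (Finset.mem_univ c)
  -- Gives d ≤ D (1 + log N) for admissible p.
  set D : ℝ := |β| * (nu + ny) + f * nu with hD
  obtain ⟨N₀, hN₀⟩ := exists_forall_mul_sq_log_le (M * D ^ 2) hε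
  have hsmall : ∀ x : ℕ × ℕ, ∃ c : ℝ, 0 < c ∧ (0 < x.2 → dimP nu ny x.1 f * (x.1 + f) ≤ x.2 →
      μ.real (dataExcited S u e x.1 f x.2 c)ᶜ ≤ ε) := by
    intro x
    by_cases h : 0 < x.2 ∧ dimP nu ny x.1 f * (x.1 + f) ≤ x.2
    · obtain ⟨c, hc, hle⟩ := exists_dataExcited hSe hAK hξ hv h.1 h.2 hε
      exact ⟨c, hc, fun _ _ => hle⟩
    · exact ⟨1, one_pos, fun h1 h2 => absurd ⟨h1, h2⟩ h⟩
  choose g hg hgle using hsmall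
  -- Since p ≤ d ≤ d² ≤ N, the pairs with N < N₀ lie in a finite square.
  obtain ⟨c₂, hc₂, hc₂le⟩ := exists_pos_forall_le (Finset.range N₀ ×ˢ Finset.range N₀) hg
  refine ⟨min c₁ c₂, lt_min hc₁ hc₂, fun p N hp hpN hdN => ?_⟩
  have hd := add_le_dimP (p := p) (i := f) hnu hny
  have hdN' : dimP nu ny p f * (p + f) ≤ N :=
    (Nat.mul_le_mul_left _ (by omega)).trans ((sq (dimP nu ny p f)).symm.le.trans hdN)
  have hpleN : p ≤ N := le_trans (by omega) ((Nat.le_self_pow two_ne_zero _).trans hdN)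
  have hN : 0 < N := by omega
  rcases le_or_gt N₀ N with hcase | hcase
  · refine (measureReal_mono (Set.compl_subset_compl.2
      (dataExcited_anti (min_le_left c₁ c₂)))).trans ((hlarge p f N hN).trans
        (le_trans ?_ (hN₀ N hcase)))
    have hN1 : (1 : ℝ) ≤ N := by exact_mod_cast hN
    have hlog : 0 ≤ Real.log N := Real.log_nonneg hN1
    have h1 : (dimP nu ny p f : ℝ) ≤ D * (1 + Real.log N) := by
      have h2 : (p : ℝ) ≤ |β| * (1 + Real.log N) :=
        hpN.trans (mul_le_mul_of_nonneg_right (le_abs_self β) (by linarith))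
      have h3 := mul_le_mul_of_nonneg_right h2 (by positivity : (0 : ℝ) ≤ nu + ny)
      have h4 : 0 ≤ (f : ℝ) * nu * Real.log N := by positivity
      simp only [dimP, hD]
      push_cast
      linarith
    have h5 : (dimP nu ny p f : ℝ) ^ 2 ≤ D ^ 2 * (1 + Real.log N) ^ 2 := by
      rw [← mul_pow]
      exact pow_le_pow_left₀ (by positivity) h1 2
    rw [mul_assoc]
    gcongr
  · refine (measureReal_mono (Set.compl_subset_compl.2
      (dataExcited_anti ((min_le_right c₁ c₂).trans (hc₂le (p, N) ?_))))).trans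
        (hgle (p, N) hN hdN')
    simp only [Finset.mem_product, Finset.mem_range]
    omega

end DataBounds

lemma deltaU_nonneg {nu f N : ℕ} (hf : 1 ≤ f) : 0 ≤ deltaU nu f N := by
  have h1 : (1 : ℝ) ≤ f := by exact_mod_cast hf
  have h2 : (0 : ℝ) ≤ N := Nat.cast_nonneg N
  exact Real.rpow_nonneg (mul_nonneg (by linarith) (Nat.cast_nonneg nu)) _

end SubspaceId

/-! ### Assembly of the theorem -/

open SubspaceId in
theorem lemma4 {nx nu ny : ℕ} (hnu : 0 < nu) (hny : 0 < ny) (S : LinSys nx nu ny)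
    (hSe : S.Se.PosDef) (hA : specRad S.A < 1) (hAK : specRad S.AK < 1)
    (hctrb : Controllable S.A (Matrix.fromCols S.B S.K)) (hobsv : Observable S.A S.C)
    {Ω : Type*} [MeasurableSpace Ω] (μ : Measure Ω) [IsProbabilityMeasure μ]
    (u : RandSeq Ω nu) (e : RandSeq Ω ny) (σ : ℝ) (hσ : 0 < σ)
    (hu : IsGaussianWhiteNoise μ u (σ ^ 2)) (he : IsGaussianWhiteNoise μ e 1)
    (hue : IndepFun (fun ω k => u k ω) (fun ω k => e k ω) μ)
    (f : ℕ) (hf : 1 ≤ f) (δ : ℝ) (hδ0 : 0 < δ) (hδ1 : δ < 1) (β : ℝ) :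
    ∃ C₁ C₂ : ℝ, ∀ p N : ℕ, 1 ≤ p → (p : ℝ) ≤ β * (1 + Real.log N) →
      burnIn S μ u e σ δ p f ≤ N →
        1 - 3 * δ / 2 - deltaU nu f N ≤
          μ.real {ω | (Uf u p f N ω * (Uf u p f N ω)ᵀ).PosDef ∧
            (W2 S u e p f N ω).PosDef ∧
            ‖W2 S u e p f N ω‖ ≤ C₁ * Real.log N ∧
            ‖(W2 S u e p f N ω)⁻¹‖ ≤ C₂} := by
  have hξ := isScalarNoise_noise hu he hue
  have hv : ∀ c : Fin nu ⊕ Fin ny,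
      Sum.elim (fun _ => (σ ^ 2).toNNReal) (fun _ => (1 : ℝ).toNNReal) c ≠ 0 := by
    rintro (c | c)
    · simpa using hσ.ne'
    · simp
  have hδ2 : 0 < δ / 2 := by linarith
  obtain ⟨c, hc, hlow⟩ := exists_dataExcited_uniform hnu hny hSe hA hAK hξ hv f β hδ2
  obtain ⟨B, hB, hupp⟩ := LinSys.exists_measure_sum_sq_Zp_le hA hξ
  -- The first constant comes from B p/(δ/2) with p ≤ 2|β| log² N, which uses log N ≥ 1.
  refine ⟨√(4 * B * |β| / δ), √c⁻¹, fun p N hp hpN hburn => ?_⟩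
  have hdN := sq_dimP_le_of_burnIn_le hnu hny hp hf hδ0 hδ1 hburn
  have hd := add_le_dimP (p := p) (i := f) hnu hny
  have hN3 : 3 ≤ N := by nlinarith
  have hN : 0 < N := by omega
  have hlog : 1 ≤ Real.log N := one_le_log_of_three_le (by exact_mod_cast hN3)
  have h1 := hlow p N hp hpN hdN
  have h2 := hupp p N (δ / 2) hδ2 hp hN
  set E : Set Ω := {ω | ¬ ∑ j, ∑ i, Zp S u e p N ω i j ^ 2 ≤ N * (B * p / (δ / 2))}
  set G : Set Ω := {ω | (Uf u p f N ω * (Uf u p f N ω)ᵀ).PosDef ∧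
            (W2 S u e p f N ω).PosDef ∧
            ‖W2 S u e p f N ω‖ ≤ √(4 * B * |β| / δ) * Real.log N ∧
            ‖(W2 S u e p f N ω)⁻¹‖ ≤ √c⁻¹}
  -- Covering the whole space and using subadditivity needs no measurability of the events.
  have hcover : (Set.univ : Set Ω) ⊆ G ∪ ((dataExcited S u e p f N c)ᶜ ∪ E) := by
    intro ω _
    by_cases hω1 : ω ∈ dataExcited S u e p f N c
    · by_cases hω2 : ω ∈ E
      · exact Or.inr (Or.inr hω2)
      · refine Or.inl ?_
        obtain ⟨g1, g2, g3, g4⟩ := weighting_bounds hN hc (by positivity) hω1 (not_not.1 hω2)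
        refine ⟨g1, g2, g3.trans ?_, g4⟩
        rw [← Real.sqrt_sq (by linarith : 0 ≤ Real.log N), ← Real.sqrt_mul (by positivity)]
        refine Real.sqrt_le_sqrt ?_
        have h3 : (p : ℝ) ≤ |β| * (2 * Real.log N ^ 2) :=
          hpN.trans (mul_le_mul (le_abs_self β) (by nlinarith) (by linarith) (abs_nonneg β))
        have h4 : B * p / (δ / 2) ≤ B * (|β| * (2 * Real.log N ^ 2)) / (δ / 2) := by gcongr
        refine h4.trans (le_of_eq ?_)
        field_simp
        ring
    · exact Or.inr (Or.inl hω1)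
  have hmeas : 1 ≤ μ.real G + (μ.real (dataExcited S u e p f N c)ᶜ + μ.real E) := by
    calc (1 : ℝ) = μ.real Set.univ := by simp
      _ ≤ μ.real (G ∪ ((dataExcited S u e p f N c)ᶜ ∪ E)) := measureReal_mono hcover
      _ ≤ _ := (measureReal_union_le _ _).trans (add_le_add le_rfl (measureReal_union_le _ _))
  have := deltaU_nonneg (nu := nu) (N := N) hf
  linarith
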